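/- **Setting.** Let $n\ge 1$, let $F$ be a non-archimedean local field with ring of integers $\mathfrak o$, uniformizer $\varpi$ and residue field $k$ of cardinality $v^{-1}\equiv 1 \bmod 2n$. Let $\iota:\mu_n(F)\to\mathbb C^\times$ be an injective homomorphism and let $\psi$ be an additive character of $F$ that is trivial on $\mathfrak o$ but not on $\varpi^{-1}\mathfrak o$. For $a\in\mathbb Z$ let $$g(a)=v\sum_{u}\iota\big((u,\varpi)_n\big)^a\,\psi(u/\varpi),$$ where $u$ runs through representatives in $\mathfrak o^\times$ of $k^\times$ and the Hilbert symbol $(u,\varpi)_n$ is the $n$-th root of unity in $F$ congruent to $u^{(v^{-1}-1)/n}$ modulo $\varpi\mathfrak o$. Let $\Lambda$ be the character lattice of a reduced root datum with finite set of roots $\Delta\subset\Lambda$, simple roots $\alpha_i$ and simple reflections $s_i$, and let $m_{ij}$ be the order of $s_is_j$. Let $B:\Lambda\times\Lambda\to\mathbb Z$ be a symmetric bilinear form, invariant under the Weyl group and even on the root lattice. Put $Q(\mu)=B(\mu,\mu)/2$, $n_i=n/\gcd(n,Q(\alpha_i))$ and $$\Lambda^{(n)}=\{\mu\in\Lambda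 : B(y,\mu)\equiv 0 \bmod n\ \text{ for all } y\in\Lambda\},$$ and let $\Gamma\subset\Lambda$ be a set of representatives of $\Lambda/\Lambda^{(n)}$. Let $\mathbb C(\Lambda)$ be the field of fractions of the group algebra $\mathbb C[\Lambda]=\bigoplus_{\lambda}\mathbb C\,\mathbf z^\lambda$, on which $s_i$ acts by $s_i\mathbf z^\lambda=\mathbf z^{s_i\lambda}$. Index the components of $\mathbf f\in\mathbb C(\Lambda)^{|\Gamma|}$ by $\Gamma$, reading an index $\mu\in\Lambda$ as the representative of its class. Define $\mathbb C$-linear operators on $\mathbb C(\Lambda)^{|\Gamma|}$ by $$(\mathbf T_i\mathbf f)^\mu=\frac{1-v}{\mathbf z^{n_i\alpha_i}-1}\,\mathbf f^\mu+s_i\Big(\frac{1-v}{1-\mathbf z^{-n_i\alpha_i}}\,\mathbf z^{-r_i(\mu)\alpha_i}\,\mathbf f^\mu+g\big(Q(\alpha_i)-B(\alpha_i,\mu)\big)\,\mathbf z^{\alpha_i}\,\mathbf f^{\,s_i\mu+\alpha_i}\Big),$$ where $r_i(\mu)\in\{0,\dots,n_i-1\}$ is the residue of the integer $-B(\alpha_i,\mu)/Q(\alpha_i)$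 modulo $n_i$ (if $Q(\alpha_i)=0$, then $n_i=1$ and $r_i(\mu)=0$). Let $\widetilde{\mathcal H}^{(n)}_v$ be the (extended) affine metaplectic Iwahori Hecke algebra: the unital $\mathbb C$-algebra with generators $T_i$ (one for each simple root) and $\vartheta_\lambda$ ($\lambda\in\Lambda^{(n)}$) and relations $T_i^2=(v-1)T_i+v$; the braid relations $T_iT_jT_i\cdots=T_jT_iT_j\cdots$ ($m_{ij}$ factors on each side); $\vartheta_0=1$ and $\vartheta_\lambda\vartheta_\mu=\vartheta_{\lambda+\mu}$; and the Bernstein relations $$\vartheta_\lambda T_i-T_i\vartheta_{s_i\lambda}=(v-1)\,\frac{\vartheta_\lambda-\vartheta_{s_i\lambda}}{1-\vartheta_{-n_i\alpha_i}},$$ where the quotient is taken in the group algebra of $\Lambda^{(n)}$. **Theorem.** There is an action of $\widetilde{\mathcal H}^{(n)}_v$ on $\mathbb C(\Lambda)^{|\Gamma|}$ (a homomorphism of $\mathbb C$-algebras to $\operatorname{End}_{\mathbb C}(\mathbb C(\Lambda)^{|\Gamma|})$) in which each $T_i$ acts by $\mathbf T_i$ and each $\vartheta_\lambda$, $\lambda\in\Lambda^{(n)}$,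 acts by multiplication by $\mathbf z^{-\lambda}$. In particular the $\mathbf T_i$ satisfy the braid relations $\mathbf T_i\mathbf T_j\mathbf T_i\cdots=\mathbf T_j\mathbf T_i\mathbf T_j\cdots$ ($m_{ij}$ factors on each side) and the quadratic relations $(\mathbf T_i-v)(\mathbf T_i+1)=0$. -/

import Mathlib

open ValuativeRel

noncomputable section

/-! ### Gauss sums of a non-archimedean local field -/

section LocalField

variable (F : Type*) [Field F] [ValuativeRel F] [TopologicalSpace F]
  [IsNonarchimedeanLocalField F]

/-- The parameter `v`, the inverse of the cardinality of the residue field. -/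
def localV : ℂ := (Nat.card 𝓀[F] : ℂ)⁻¹

variable {F}

/-- If `n` divides `q - 1`, with `q` the cardinality of the residue field, then for every non-zero
residue class `t` the class `t ^ ((q - 1) / n)` lifts to an `n`-th root of unity of `F`. -/
theorem exists_rootOfUnity_lift {n : ℕ} (hn : Nat.card 𝓀[F] ≡ 1 [MOD 2 * n]) (t : 𝓀[F]ˣ) :
    ∃ ζ : rootsOfUnity n F, ∃ x : 𝒪[F], (x : F) = ((ζ : Fˣ) : F) ∧
      IsLocalRing.residue 𝒪[F] x = (t : 𝓀[F]) ^ ((Nat.card 𝓀[F] - 1) / n) := by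
  let _ : UniformSpace F := IsTopologicalAddGroup.rightUniformSpace F
  have : IsUniformAddGroup F := isUniformAddGroup_of_addCommGroup (G := F)
  have : HenselianRing 𝒪[F] 𝓂[F] := inferInstance
  let _ : Fintype 𝓀[F] := Fintype.ofFinite _
  have hq1 : 1 < Nat.card 𝓀[F] := Finite.one_lt_card
  have hdvd : n ∣ Nat.card 𝓀[F] - 1 :=
    (Dvd.intro_left 2 rfl).trans ((Nat.modEq_iff_dvd' hq1.le).1 hn.symm)
  have hn0 : n ≠ 0 := by rintro rfl; have := Nat.eq_zero_of_zero_dvd hdvd; omega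
  have hnk : (n : 𝓀[F]) ≠ 0 := by
    intro h
    have h1 : ((Nat.card 𝓀[F] - 1 : ℕ) : 𝓀[F]) = 0 := by
      obtain ⟨c, hc⟩ := hdvd
      rw [hc, Nat.cast_mul, h, zero_mul]
    rw [Nat.cast_sub hq1.le, Nat.card_eq_fintype_card, FiniteField.cast_card_eq_zero] at h1
    simp at h1
  obtain ⟨a, ha⟩ := IsLocalRing.residue_surjective (R := 𝒪[F])
    ((t : 𝓀[F]) ^ ((Nat.card 𝓀[F] - 1) / n))
  have hpow : (IsLocalRing.residue 𝒪[F] a) ^ n = 1 := by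
    rw [ha, ← pow_mul, Nat.div_mul_cancel hdvd, Nat.card_eq_fintype_card]
    exact FiniteField.pow_card_sub_one_eq_one _ t.ne_zero
  have hane : IsLocalRing.residue 𝒪[F] a ≠ 0 := by
    intro h; rw [h, zero_pow hn0] at hpow; exact zero_ne_one hpow
  obtain ⟨x, hx, hxa⟩ := HenselianRing.is_henselian (R := 𝒪[F]) (I := 𝓂[F])
    (Polynomial.X ^ n - 1) (by simpa using Polynomial.monic_X_pow_sub_C (1 : 𝒪[F]) hn0) a
    (by
      rw [← IsLocalRing.residue_eq_zero_iff]
      simp [hpow])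
    (by
      change IsUnit (IsLocalRing.residue 𝒪[F] _)
      refine IsUnit.mk0 _ ?_
      simp only [Polynomial.derivative_sub, Polynomial.derivative_X_pow, Polynomial.derivative_one,
        sub_zero, Polynomial.eval_mul, Polynomial.eval_pow, Polynomial.eval_X, map_mul, map_pow]
      rw [Polynomial.eval_C, map_natCast]
      exact mul_ne_zero hnk (pow_ne_zero _ hane))
  have hx1 : (x : F) ^ n = 1 := by
    have h : x ^ n = 1 := by simpa [Polynomial.IsRoot, sub_eq_zero] using hx
    simpa using congrArg (fun y : 𝒪[F] => (y : F)) h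
  have : NeZero n := ⟨hn0⟩
  refine ⟨rootsOfUnity.mkOfPowEq (x : F) hx1, x, by simp, ?_⟩
  rw [← ha, ← sub_eq_zero, ← map_sub]
  exact (IsLocalRing.residue_eq_zero_iff _).2 hxa

/-- The `n`-th power Hilbert symbol `(u, ϖ)_n` of a unit `u` with residue class `t` and a
uniformizer `ϖ`: the `n`-th root of unity of `F` that is congruent to `u ^ ((q - 1) / n)`
modulo the maximal ideal. -/
def unitHilbertSymbol {n : ℕ} (hn : Nat.card 𝓀[F] ≡ 1 [MOD 2 * n]) (t : 𝓀[F]ˣ) :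
    rootsOfUnity n F :=
  (exists_rootOfUnity_lift hn t).choose

/-- A lift of a residue class to the ring of integers. -/
def residueLift (t : 𝓀[F]) : 𝒪[F] :=
  Function.surjInv (IsLocalRing.residue_surjective (R := 𝒪[F])) t

/-- The Gauss sum `g(a) = v ∑_u ε((u, ϖ)_n)^a ψ(u / ϖ)`, where `u` runs through representatives
of the units modulo `1 + 𝔭`. -/
def metaplecticGaussSum {n : ℕ} (hn : Nat.card 𝓀[F] ≡ 1 [MOD 2 * n]) (ϖ : 𝒪[F])
    (ε : rootsOfUnity n F →* ℂˣ) (ψ : AddChar F ℂ) (a : ℤ) : ℂ :=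
  localV F * ∑ᶠ t : 𝓀[F]ˣ, ((ε (unitHilbertSymbol hn t) ^ a : ℂˣ) : ℂ) *
    ψ ((residueLift (t : 𝓀[F]) : F) / (ϖ : F))

end LocalField

/-! ### Rational functions on the torus -/

section RatFun

variable (X : Type*) [AddCommGroup X]

instance instIsDomainGroupAlgebra [Module.Free ℤ X] : IsDomain (AddMonoidAlgebra ℂ X) := by
  have : UniqueSums X := UniqueSums.of_injective_addHom
    (Module.Free.chooseBasis ℤ X).repr.toAddEquiv.toAddHom
    (Module.Free.chooseBasis ℤ X).repr.injective inferInstance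
  infer_instance

/-- `ℂ(Λ)`, the field of fractions of the group algebra `ℂ[Λ]`. -/
abbrev LatticeRatFun : Type _ := FractionRing (AddMonoidAlgebra ℂ X)

variable {X}

/-- The monomial `z ^ μ` in `ℂ(Λ)`. -/
def zMon (μ : X) : LatticeRatFun X :=
  algebraMap (AddMonoidAlgebra ℂ X) (LatticeRatFun X) (AddMonoidAlgebra.single μ 1)

/-- The automorphism of `ℂ(Λ)` with `z ^ μ ↦ z ^ (w μ)` that an automorphism `w` of `Λ` induces. -/
def ratFunAut (w : X ≃+ X) : LatticeRatFun X ≃ₐ[ℂ] LatticeRatFun X :=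
  IsFractionRing.algEquivOfAlgEquiv (AddMonoidAlgebra.domCongr ℂ ℂ w)

end RatFun

/-- The alternating product `a b a ⋯` with `m` factors. -/
def altProd {M : Type*} [Monoid M] : ℕ → M → M → M
  | 0, _, _ => 1
  | m + 1, a, b => a * altProd m b a

/-- The combinatorial data of an `n`-fold metaplectic cover: a root datum with character lattice
`X` (the lattice `Λ`, containing the roots `α`), a choice of simple roots, the degree `n`, and
a Weyl-invariant symmetric integral bilinear form on `Λ` that is even on the root lattice. -/
structure MetaplecticDatum (ι X Y : Type*) [AddCommGroup X] [AddCommGroup Y] where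
  P : RootDatum ι X Y
  base : P.Base
  n : ℕ
  n_pos : 0 < n
  B : LinearMap.BilinForm ℤ X
  symm : ∀ x y, B x y = B y x
  invariant : ∀ i x y, B (P.reflection i x) (P.reflection i y) = B x y
  even : ∀ x ∈ Submodule.span ℤ (Set.range P.root), Even (B x x)

namespace MetaplecticDatum

variable {ι X Y : Type*} [AddCommGroup X] [AddCommGroup Y] (D : MetaplecticDatum ι X Y)

/-- The index set of the simple roots. -/
abbrev Simple : Type _ := D.base.support

/-- The simple root `α_i`. -/
def α (i : D.Simple) : X := D.P.root i

/-- The simple reflection `s_i` of `Λ`. -/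
def s (i : D.Simple) : X ≃ₗ[ℤ] X := D.P.reflection i

/-- `Q(x) = B(x, x) / 2`. -/
def Q (x : X) : ℤ := D.B x x / 2

/-- `n_i = n / gcd(n, Q(α_i))`. -/
def nn (i : D.Simple) : ℕ := D.n / Int.gcd D.n (D.Q (D.α i))

/-- The order of `s_i s_j`. -/
def m (i j : D.Simple) : ℕ := orderOf (D.s i * D.s j)

/-- The lattice `Λ^(n)`. -/
def Λn : AddSubgroup X where
  carrier := {μ | ∀ y, (D.n : ℤ) ∣ D.B y μ}
  add_mem' ha hb y := by rw [map_add]; exact dvd_add (ha y) (hb y)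
  zero_mem' y := by simp
  neg_mem' ha y := by rw [map_neg]; exact (dvd_neg).2 (ha y)

theorem s_mem (i : D.Simple) {μ : X} (hμ : μ ∈ D.Λn) : D.s i μ ∈ D.Λn := by
  intro y
  have h := D.invariant i (D.s i y) μ
  have h2 : D.P.reflection i (D.s i y) = y := by simp [s]
  rw [h2] at h
  change _ ∣ D.B y (D.P.reflection i μ)
  rw [h]
  exact hμ _

theorem nn_smul_mem (i : D.Simple) : (D.nn i : ℤ) • D.α i ∈ D.Λn := by
  intro y
  have h := D.invariant i y (D.α i)
  have hα : D.P.reflection i (D.α i) = -D.α i := by simp [α]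
  rw [hα, RootPairing.reflection_apply] at h
  change D.B (y - _ • D.α i) _ = _ at h
  simp only [map_neg, map_sub, map_smul, LinearMap.sub_apply, LinearMap.smul_apply,
    smul_eq_mul] at h
  obtain ⟨q, hq⟩ := D.even (D.α i) (Submodule.subset_span ⟨_, rfl⟩)
  have hQ : D.Q (D.α i) = q := by rw [Q, hq]; omega
  have hB : ∃ c : ℤ, D.B y (D.α i) = q * c := 
    ⟨D.P.coroot' i y, by rw [hq] at h; linarith⟩
  obtain ⟨c, hc⟩ := hB
  rw [map_smul, smul_eq_mul, hc, nn, hQ]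
  obtain ⟨d, hd⟩ := Int.gcd_dvd_right (D.n : ℤ) q
  have hg : Int.gcd D.n q ∣ D.n := by exact_mod_cast Int.gcd_dvd_left (D.n : ℤ) q
  have e : ((D.n / Int.gcd D.n q : ℕ) : ℤ) * (Int.gcd D.n q : ℤ) = D.n := by
    exact_mod_cast Nat.div_mul_cancel hg
  refine ⟨d * c, ?_⟩
  calc _ = ((D.n / Int.gcd D.n q : ℕ) : ℤ) * ((Int.gcd D.n q * d) * c) := by rw [← hd]
    _ = (((D.n / Int.gcd D.n q : ℕ) : ℤ) * (Int.gcd D.n q : ℤ)) * (d * c) := by ring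
    _ = _ := by rw [e]

/-- `s_i` on `Λ^(n)`. -/
def sΛn (i : D.Simple) (μ : D.Λn) : D.Λn := ⟨D.s i μ, D.s_mem i μ.2⟩

/-- `n_i α_i` as an element of `Λ^(n)`. -/
def nα (i : D.Simple) : D.Λn := ⟨(D.nn i : ℤ) • D.α i, D.nn_smul_mem i⟩

/-! ### The affine metaplectic Hecke algebra -/

/-- Generators of the affine metaplectic Hecke algebra. -/
inductive HeckeGen : Type _
  | T (i : D.Simple) : HeckeGen
  | θ (μ : D.Λn) : HeckeGen

/-- The generator `T_i` in the free algebra. -/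
def freeT (i : D.Simple) : FreeAlgebra ℂ D.HeckeGen := FreeAlgebra.ι ℂ (HeckeGen.T i)

/-- The generator `ϑ_μ` in the free algebra. -/
def freeθ (μ : D.Λn) : FreeAlgebra ℂ D.HeckeGen := FreeAlgebra.ι ℂ (HeckeGen.θ μ)

/-- The linear extension of `μ ↦ ϑ_μ` to the group algebra of `Λ^(n)`. -/
def freeθLin (x : AddMonoidAlgebra ℂ D.Λn) : FreeAlgebra ℂ D.HeckeGen :=
  x.coeff.sum fun μ c => c • D.freeθ μ

/-- The defining relations of the affine metaplectic Hecke algebra. In the Bernstein relation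
`x` is the quotient `(ϑ_μ - ϑ_{s_i μ}) / (1 - ϑ_{- n_i α_i})`, computed in the group algebra
of `Λ^(n)`. -/
inductive HeckeRel (v : ℂ) : FreeAlgebra ℂ D.HeckeGen → FreeAlgebra ℂ D.HeckeGen → Prop
  | quadratic (i : D.Simple) :
      HeckeRel v (D.freeT i * D.freeT i) ((v - 1) • D.freeT i + v • 1)
  | braid (i j : D.Simple) :
      HeckeRel v (altProd (D.m i j) (D.freeT i) (D.freeT j))
        (altProd (D.m i j) (D.freeT j) (D.freeT i))
  | θ_zero : HeckeRel v (D.freeθ 0) 1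
  | θ_add (μ ν : D.Λn) : HeckeRel v (D.freeθ μ * D.freeθ ν) (D.freeθ (μ + ν))
  | bernstein (i : D.Simple) (μ : D.Λn) (x : AddMonoidAlgebra ℂ D.Λn)
      (hx : x * (1 - AddMonoidAlgebra.single (-D.nα i) 1) =
        AddMonoidAlgebra.single μ 1 - AddMonoidAlgebra.single (D.sΛn i μ) 1) :
      HeckeRel v (D.freeθ μ * D.freeT i - D.freeT i * D.freeθ (D.sΛn i μ))
        ((v - 1) • D.freeθLin x)

/-- The (extended) affine metaplectic Hecke algebra. -/
abbrev Hecke (v : ℂ) : Type _ := RingQuot (D.HeckeRel v)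

/-- The generator `T_i` of the Hecke algebra. -/
def heckeT (v : ℂ) (i : D.Simple) : D.Hecke v := RingQuot.mkAlgHom ℂ (D.HeckeRel v) (D.freeT i)

/-- The generator `ϑ_μ` of the Hecke algebra. -/
def heckeθ (v : ℂ) (μ : D.Λn) : D.Hecke v := RingQuot.mkAlgHom ℂ (D.HeckeRel v) (D.freeθ μ)

/-! ### The Demazure-Whittaker operators -/

/-- `Γ` is a system of representatives of `Λ / Λ^(n)`. -/
def IsRepSystem (Γ : Set X) : Prop := ∀ μ : X, ∃! γ : Γ, μ - γ ∈ D.Λn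

/-- The representative in `Γ` of the class of `μ`. -/
def rep {Γ : Set X} (hΓ : D.IsRepSystem Γ) (μ : X) : Γ := (hΓ μ).choose

variable [Module.Free ℤ X]

/-- The action of `s_i` on `ℂ(Λ)`. -/
def sRat (i : D.Simple) : LatticeRatFun X ≃ₐ[ℂ] LatticeRatFun X := ratFunAut (D.s i).toAddEquiv

/-- `D_{n_i}(z⁻¹) = (1 - v) / (z ^ (n_i α_i) - 1)`. -/
def Dcoef (v : ℂ) (i : D.Simple) : LatticeRatFun X :=
  algebraMap ℂ _ (1 - v) / (zMon ((D.nn i : ℤ) • D.α i) - 1)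

/-- `τ¹_{μ, μ}(z⁻¹) = (1 - v) / (1 - z ^ (- n_i α_i)) * z ^ (- r α_i)`, where `r` is the least
nonnegative residue of `- B(α_i, μ) / Q(α_i)` modulo `n_i`. The division `B(α_i, μ) / Q(α_i)` is
exact; where `Q(α_i) = 0` one has `n_i = 1` and `r = 0`. -/
def τ₁ (v : ℂ) (i : D.Simple) (μ : X) : LatticeRatFun X :=
  algebraMap ℂ _ (1 - v) / (1 - zMon (-((D.nn i : ℤ) • D.α i))) *
    zMon (-(((-(D.B (D.α i) μ / D.Q (D.α i))) % (D.nn i : ℤ)) • D.α i))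

/-- `τ²_{μ, s_i μ + α_i}(z⁻¹) = g(Q(α_i) - B(α_i, μ)) * z ^ α_i`. -/
def τ₂ (g : ℤ → ℂ) (i : D.Simple) (μ : X) : LatticeRatFun X :=
  algebraMap ℂ _ (g (D.Q (D.α i) - D.B (D.α i) μ)) * zMon (D.α i)

/-- The operator `τ(z⁻¹)` attached to the simple reflection `s_i`. -/
def τ (v : ℂ) (g : ℤ → ℂ) {Γ : Set X} (hΓ : D.IsRepSystem Γ) (i : D.Simple) :
    Module.End ℂ (Γ → LatticeRatFun X) where
  toFun f μ := D.τ₁ v i μ * f μ + D.τ₂ g i μ * f (D.rep hΓ (D.s i μ + D.α i))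
  map_add' f f' := by funext μ; simp only [Pi.add_apply]; ring
  map_smul' c f := by
    funext μ; simp only [Pi.smul_apply, RingHom.id_apply, mul_smul_comm, smul_add]

/-- The vector metaplectic Demazure-Whittaker operator `D_{n_i}(z⁻¹) + s_i τ(z⁻¹)`. -/
def demazure (v : ℂ) (g : ℤ → ℂ) {Γ : Set X} (hΓ : D.IsRepSystem Γ) (i : D.Simple) :
    Module.End ℂ (Γ → LatticeRatFun X) where
  toFun f μ := D.Dcoef v i * f μ + D.sRat i (D.τ v g hΓ i f μ)
  map_add' f f' := by funext μ; simp only [map_add, Pi.add_apply]; ring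
  map_smul' c f := by
    funext μ; simp only [map_smul, Pi.smul_apply, RingHom.id_apply, mul_smul_comm, smul_add]

end MetaplecticDatum

end

/-! ### Yang-Baxter identities in dihedral Hecke algebras -/

section YangBaxter

variable {K A : Type*} [Field K] [Ring A] [Algebra K A]

/-! Write `T_i = d_i + I_i`, where `d_i = (1 - v) / (Z_i - 1)` and `Z_i = z^(n_i α_i)`. Since `d_i`
acts as a scalar of `K = ℂ(Λ)`, the remaining part `I_i = s_i τ`, the `intertwiner`, is semilinear
over `K` with respect to `s_i`. This semilinearity is the Bernstein relation (`demazure_smul`).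
Because `d_i + s_i d_i = v - 1`, the quadratic relation amounts to `I_i² = v + d_i · s_i d_i`. That
is checked on the spanning vectors `vec μ = z^(-μ) e_μ` (`inter_inter_vec`) and uses only `g(a)
g(-a) = v` for `n ∤ a` and `g(a) = -v` for `n ∣ a`.

For the braid relation of `T = T_i`, `U = T_j`, let `Δ` be the difference of the two alternating
products. The Yang-Baxter identities, which need only the quadratic relations, show that `Δ` is also
the difference of the alternating products of intertwiners. Hence `Δ` is semilinear over `K` and its
kernel is a `K`-subspace. Moreover `Δ T = r Δ` for some `r`, and likewise for `U`
(`exists_altProd_sub_altProd_mul`), so the kernel is stable under `T` and `U`.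

It remains to find enough vectors in the kernel. Up to a scalar in `K`, `vec μ` depends only on the
class of `μ` modulo `Λ^(n)`, so `μ` may be moved by multiples of `n_i α_i` and `n_j α_j` until an
invariant quadratic form is minimal (`exists_isMinimalPair`). Then the shifted coroot pairings `ℓ`
of `μ` satisfy `|ℓ| ≤ n_i`, respectively `|ℓ| ≤ n_j`, and for `-n_i ≤ ℓ ≤ 0` the operator `T_i`
sends `vec μ` to a complex multiple of a single `vec` (`demazure_vec`). If both pairings are
nonpositive, the two alternating products can be followed along the orbit and agree. Every other
minimal weight is reached from such a one by `T` and `U` (`mem_of_isMinimalPair`).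
`altProd_eq_of_rankTwoOrbit` assembles the argument. -/

theorem mul_sub_alternating_three {a b : A} {κ : K} (ha : a * a = κ • 1) (hb : b * b = κ • 1)
    (y₁ y₂ y₃ : K) :
    (a - y₁ • 1) * ((b - y₂ • 1) * (a - y₃ • 1)) - (b - y₃ • 1) * ((a - y₂ • 1) * (b - y₁ • 1)) =
      a * (b * a) - b * (a * b) + (y₁ * y₂ + y₂ * y₃ - y₁ * y₃) • (a - b) := by
  simp only [sub_mul, mul_sub, smul_mul_assoc, mul_smul_comm, mul_one, one_mul, ha, hb]
  module

theorem mul_sub_alternating_four {a b : A} {κ : K} (ha : a * a = κ • 1) (hb : b * b = κ • 1)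
    (y₁ y₂ y₃ y₄ : K) :
    (a - y₁ • 1) * ((b - y₂ • 1) * ((a - y₃ • 1) * (b - y₄ • 1))) -
        (b - y₄ • 1) * ((a - y₃ • 1) * ((b - y₂ • 1) * (a - y₁ • 1))) =
      a * (b * (a * b)) - b * (a * (b * a)) +
        (y₁ * y₂ + y₂ * y₃ + y₃ * y₄ - y₁ * y₄) • (a * b - b * a) := by
  have ha' (x : A) : a * (a * x) = κ • x := by rw [← mul_assoc, ha, smul_mul_assoc, one_mul]
  have hb' (x : A) : b * (b * x) = κ • x := by rw [← mul_assoc, hb, smul_mul_assoc, one_mul]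
  simp only [sub_mul, mul_sub, smul_mul_assoc, mul_smul_comm, mul_one, one_mul, ha, hb, ha', hb']
  module

/-- In the antisymmetrised expansion only alternating words of the same length parity as the full
word survive. The parameters enter through a single coefficient per shorter length, so a Yang-Baxter
identity reduces to a few scalar identities. -/
theorem mul_sub_alternating_six {a b : A} {κ : K} (ha : a * a = κ • 1) (hb : b * b = κ • 1)
    (y₁ y₂ y₃ y₄ y₅ y₆ : K) :
    (a - y₁ • 1) * ((b - y₂ • 1) * ((a - y₃ • 1) *
        ((b - y₄ • 1) * ((a - y₅ • 1) * (b - y₆ • 1))))) -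
      (b - y₆ • 1) * ((a - y₅ • 1) * ((b - y₄ • 1) *
        ((a - y₃ • 1) * ((b - y₂ • 1) * (a - y₁ • 1))))) =
      a * (b * (a * (b * (a * b)))) - b * (a * (b * (a * (b * a)))) +
        (y₁ * y₂ + y₂ * y₃ + y₃ * y₄ + y₄ * y₅ + y₅ * y₆ - y₁ * y₆) •
          (a * (b * (a * b)) - b * (a * (b * a))) +
        ((y₁ * y₂ * y₃ * y₄ + y₁ * y₂ * y₄ * y₅ + y₁ * y₂ * y₅ * y₆ + y₂ * y₃ * y₄ * y₅ +
            y₂ * y₃ * y₅ * y₆ + y₃ * y₄ * y₅ * y₆ - y₁ * y₄ * y₅ * y₆ - y₁ * y₃ * y₄ * y₆ -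
            y₁ * y₂ * y₃ * y₆) +
          κ * (y₁ * y₃ + y₂ * y₄ + y₃ * y₅ + y₄ * y₆ - y₂ * y₆ - y₁ * y₅)) •
          (a * b - b * a) := by
  have ha' (x : A) : a * (a * x) = κ • x := by rw [← mul_assoc, ha, smul_mul_assoc, one_mul]
  have hb' (x : A) : b * (b * x) = κ • x := by rw [← mul_assoc, hb, smul_mul_assoc, one_mul]
  simp only [sub_mul, mul_sub, smul_mul_assoc, mul_smul_comm, mul_one, one_mul, ha, hb, ha', hb']
  module

/-- The coefficient `(1 - v) / (Z - 1)` of a Demazure-Lusztig operator. -/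
def lusztigCoef {K : Type*} [Field K] (v Z : K) : K := (1 - v) / (Z - 1)

/-- The factor `t - x` of a Yang-Baxter product. -/
def heckeFactor {K A : Type*} [Field K] [Ring A] [Algebra K A] (t : A) (x : K) : A := t - x • 1

theorem yangBaxter_two (t u : A) (x y : K) :
    heckeFactor t x * heckeFactor u y - heckeFactor u y * heckeFactor t x = t * u - u * t := by
  simp only [heckeFactor, sub_mul, mul_sub, smul_mul_assoc, mul_smul_comm, mul_one, one_mul]
  module

variable [CharZero K]

/-- Completing the square: the shift by `(v - 1) / 2` removes the linear term and makes the
preceding expansions applicable. -/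
theorem sub_half_smul_one_mul_self {t : A} {v : K} (ht : t * t = (v - 1) • t + v • 1) :
    (t - ((v - 1) / 2) • 1) * (t - ((v - 1) / 2) • 1) = ((v + 1) / 2) ^ 2 • (1 : A) := by
  simp only [sub_mul, mul_sub, smul_mul_assoc, mul_smul_comm, mul_one, one_mul, ht]
  module

/-- After the shift the coefficient is a multiple of `(Z + 1) / (Z - 1)`, a hyperbolic cotangent in
multiplicative form. Its addition formula is what makes the Yang-Baxter coefficients independent of
`p` and `q`. -/
theorem lusztigCoef_sub_half {v Z : K} (hZ : Z - 1 ≠ 0) :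
    lusztigCoef v Z - (v - 1) / 2 = (1 - v) / 2 * ((Z + 1) / (Z - 1)) := by
  unfold lusztigCoef; field_simp; ring

theorem yangBaxter_three {t u : A} {v : K} (ht : t * t = (v - 1) • t + v • 1)
    (hu : u * u = (v - 1) • u + v • 1) {p q : K} (h₁ : p - 1 ≠ 0) (h₂ : p * q - 1 ≠ 0)
    (h₃ : q - 1 ≠ 0) :
    heckeFactor t (lusztigCoef v p) * (heckeFactor u (lusztigCoef v (p * q)) * heckeFactor t (lusztigCoef v q)) -
      heckeFactor u (lusztigCoef v q) * (heckeFactor t (lusztigCoef v (p * q)) * heckeFactor u (lusztigCoef v p)) =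
      t * (u * t) - u * (t * u) := by
  simp only [heckeFactor]
  have ha := sub_half_smul_one_mul_self ht
  have hb := sub_half_smul_one_mul_self hu
  set h : K := (v - 1) / 2 with hh
  have key (y₁ y₂ y₃ : K) := mul_sub_alternating_three ha hb (y₁ - h) (y₂ - h) (y₃ - h)
  have e (x : A) (y : K) : x - h • 1 - (y - h) • 1 = x - y • (1 : A) := by module
  simp only [e] at key
  -- At zero parameters the same expansion computes `t u t - u t u`, so only the coefficients of the
  -- shorter words have to be compared.
  have k₀ := key 0 0 0
  simp only [zero_smul, sub_zero] at k₀
  rw [key, k₀]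
  congr 2
  rw [hh, lusztigCoef_sub_half h₁, lusztigCoef_sub_half h₂, lusztigCoef_sub_half h₃]
  field_simp
  ring

theorem yangBaxter_four {t u : A} {v : K} (ht : t * t = (v - 1) • t + v • 1)
    (hu : u * u = (v - 1) • u + v • 1) {p q : K} (h₁ : p - 1 ≠ 0) (h₂ : p ^ 2 * q - 1 ≠ 0)
    (h₃ : p * q - 1 ≠ 0) (h₄ : q - 1 ≠ 0) :
    heckeFactor t (lusztigCoef v p) * (heckeFactor u (lusztigCoef v (p ^ 2 * q)) *
        (heckeFactor t (lusztigCoef v (p * q)) * heckeFactor u (lusztigCoef v q))) -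
      heckeFactor u (lusztigCoef v q) * (heckeFactor t (lusztigCoef v (p * q)) *
        (heckeFactor u (lusztigCoef v (p ^ 2 * q)) * heckeFactor t (lusztigCoef v p))) =
      t * (u * (t * u)) - u * (t * (u * t)) := by
  simp only [heckeFactor]
  have ha := sub_half_smul_one_mul_self ht
  have hb := sub_half_smul_one_mul_self hu
  set h : K := (v - 1) / 2 with hh
  have key (y₁ y₂ y₃ y₄ : K) :=
    mul_sub_alternating_four ha hb (y₁ - h) (y₂ - h) (y₃ - h) (y₄ - h)
  have e (x : A) (y : K) : x - h • 1 - (y - h) • 1 = x - y • (1 : A) := by module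
  simp only [e] at key
  have k₀ := key 0 0 0 0
  simp only [zero_smul, sub_zero] at k₀
  rw [key, k₀]
  congr 2
  rw [hh, lusztigCoef_sub_half h₁, lusztigCoef_sub_half h₂, lusztigCoef_sub_half h₃,
    lusztigCoef_sub_half h₄]
  field_simp
  ring

/-- The arguments run through the six positive roots of type `G₂` in the order in which a reduced
word of the longest element meets them. -/
theorem yangBaxter_six {t u : A} {v : K} (ht : t * t = (v - 1) • t + v • 1)
    (hu : u * u = (v - 1) • u + v • 1) {p q : K} (h₁ : p - 1 ≠ 0) (h₂ : p ^ 3 * q - 1 ≠ 0)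
    (h₃ : p ^ 2 * q - 1 ≠ 0) (h₄ : p ^ 3 * q ^ 2 - 1 ≠ 0) (h₅ : p * q - 1 ≠ 0)
    (h₆ : q - 1 ≠ 0) :
    heckeFactor t (lusztigCoef v p) * (heckeFactor u (lusztigCoef v (p ^ 3 * q)) *
        (heckeFactor t (lusztigCoef v (p ^ 2 * q)) * (heckeFactor u (lusztigCoef v (p ^ 3 * q ^ 2)) *
          (heckeFactor t (lusztigCoef v (p * q)) * heckeFactor u (lusztigCoef v q))))) -
      heckeFactor u (lusztigCoef v q) * (heckeFactor t (lusztigCoef v (p * q)) *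
        (heckeFactor u (lusztigCoef v (p ^ 3 * q ^ 2)) * (heckeFactor t (lusztigCoef v (p ^ 2 * q)) *
          (heckeFactor u (lusztigCoef v (p ^ 3 * q)) * heckeFactor t (lusztigCoef v p))))) =
      t * (u * (t * (u * (t * u)))) - u * (t * (u * (t * (u * t)))) := by
  simp only [heckeFactor]
  have ha := sub_half_smul_one_mul_self ht
  have hb := sub_half_smul_one_mul_self hu
  set h : K := (v - 1) / 2 with hh
  have key (y₁ y₂ y₃ y₄ y₅ y₆ : K) :=
    mul_sub_alternating_six ha hb (y₁ - h) (y₂ - h) (y₃ - h) (y₄ - h) (y₅ - h) (y₆ - h)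
  have e (x : A) (y : K) : x - h • 1 - (y - h) • 1 = x - y • (1 : A) := by module
  simp only [e] at key
  have k₀ := key 0 0 0 0 0 0
  simp only [zero_smul, sub_zero] at k₀
  set y₁ := lusztigCoef v p - h with hy₁
  set y₂ := lusztigCoef v (p ^ 3 * q) - h with hy₂
  set y₃ := lusztigCoef v (p ^ 2 * q) - h with hy₃
  set y₄ := lusztigCoef v (p ^ 3 * q ^ 2) - h with hy₄
  set y₅ := lusztigCoef v (p * q) - h with hy₅
  set y₆ := lusztigCoef v q - h with hy₆
  rw [hh, lusztigCoef_sub_half h₁] at hy₁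
  rw [hh, lusztigCoef_sub_half h₂] at hy₂
  rw [hh, lusztigCoef_sub_half h₃] at hy₃
  rw [hh, lusztigCoef_sub_half h₄] at hy₄
  rw [hh, lusztigCoef_sub_half h₅] at hy₅
  rw [hh, lusztigCoef_sub_half h₆] at hy₆
  -- The right-hand sides here and in `e₂`, `e₃` are the values at `y₁ = ⋯ = y₆ = -h`, the
  -- zero-parameter case `k₀`.
  have e₁ : y₁ * y₂ + y₂ * y₃ + y₃ * y₄ + y₄ * y₅ + y₅ * y₆ - y₁ * y₆ = 4 * h ^ 2 := by
    rw [hy₁, hy₂, hy₃, hy₄, hy₅, hy₆, hh]; field_simp; ring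
  have e₂ : y₁ * y₃ + y₂ * y₄ + y₃ * y₅ + y₄ * y₆ - y₂ * y₆ - y₁ * y₅ = 2 * h ^ 2 := by
    rw [hy₁, hy₂, hy₃, hy₄, hy₅, hy₆, hh]; field_simp; ring
  have e₃ : y₁ * y₂ * y₃ * y₄ + y₁ * y₂ * y₄ * y₅ + y₁ * y₂ * y₅ * y₆ + y₂ * y₃ * y₄ * y₅ +
      y₂ * y₃ * y₅ * y₆ + y₃ * y₄ * y₅ * y₆ - y₁ * y₄ * y₅ * y₆ - y₁ * y₃ * y₄ * y₆ -
      y₁ * y₂ * y₃ * y₆ = 3 * h ^ 4 := by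
    rw [hy₁, hy₂, hy₃, hy₄, hy₅, hy₆, hh]; field_simp; ring
  rw [key, k₀, e₁, e₂, e₃]
  module

end YangBaxter

open scoped TensorProduct

/-! ### Semilinear intertwiners of Demazure-Lusztig operators. -/

section Intertwiner

variable {K M : Type*} [Field K] [Algebra ℂ K] [AddCommGroup M] [Module ℂ M] [Module K M]
  [IsScalarTower ℂ K M]

/-- The operator `T` satisfies the quadratic Hecke relation, and the Bernstein relation
with the scalars in `K`. -/
structure IsDemazureLusztig (v : ℂ) (σ : K →ₐ[ℂ] K) (Z : K) (T : Module.End ℂ M) : Prop where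
  map_smul (f : K) (x : M) :
    T (f • x) = σ f • T x + (lusztigCoef (algebraMap ℂ K v) Z * (f - σ f)) • x
  mul_self : T * T = (v - 1) • T + v • 1

/-- The intertwiner `T - (1 - v) / (Z - 1)`. -/
def intertwiner (v : ℂ) (Z : K) (T : Module.End ℂ M) : Module.End ℂ M :=
  T - (lusztigCoef (algebraMap ℂ K v) Z • (1 : Module.End K M)).restrictScalars ℂ

theorem intertwiner_apply (v : ℂ) (Z : K) (T : Module.End ℂ M) (x : M) :
    intertwiner v Z T x = T x - lusztigCoef (algebraMap ℂ K v) Z • x := rfl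

/-- Evaluation of `K`-linear combinations of operators at a vector. -/
def evalTensor (x : M) : K ⊗[ℂ] Module.End ℂ M →ₗ[ℂ] M :=
  TensorProduct.lift (LinearMap.mk₂ ℂ (fun f r => f • r x) (fun _ _ _ => add_smul _ _ _)
    (fun c f r => smul_assoc c f (r x)) (fun f r s => smul_add f (r x) (s x))
    (fun c f r => by
      rw [LinearMap.smul_apply, ← algebraMap_smul K c (r x), smul_smul, mul_comm, ← smul_smul,
        algebraMap_smul]))

theorem evalTensor_tmul (x : M) (f : K) (r : Module.End ℂ M) :
    evalTensor x (f ⊗ₜ r) = f • r x := rfl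

theorem map_lusztigCoef (v : ℂ) (σ : K →ₐ[ℂ] K) (Z : K) :
    σ (lusztigCoef (algebraMap ℂ K v) Z) = lusztigCoef (algebraMap ℂ K v) (σ Z) := by
  simp [lusztigCoef]

theorem intertwiner_smul_of_bernstein {v : ℂ} {σ : K →ₐ[ℂ] K} {p : K} {T : Module.End ℂ M}
    (hT : ∀ (f : K) (x : M),
      T (f • x) = σ f • T x + (lusztigCoef (algebraMap ℂ K v) p * (f - σ f)) • x)
    (f : K) (x : M) : intertwiner v p T (f • x) = σ f • intertwiner v p T x := by
  rw [intertwiner_apply, intertwiner_apply, hT]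
  module

/-- With `T = I + d` and `I d = σ(d) I`, one gets `T² = I² + (d + σ d) I + d²`. The two hypotheses
turn this into `(v - 1) T + v`. -/
theorem IsDemazureLusztig.of_intertwiner {v : ℂ} {σ : K →ₐ[ℂ] K} {p : K} {T : Module.End ℂ M}
    (hT : ∀ (f : K) (x : M),
      T (f • x) = σ f • T x + (lusztigCoef (algebraMap ℂ K v) p * (f - σ f)) • x)
    (hσ : lusztigCoef (algebraMap ℂ K v) p + σ (lusztigCoef (algebraMap ℂ K v) p) =
      algebraMap ℂ K v - 1)
    (hI : ∀ x, intertwiner v p T (intertwiner v p T x) = (algebraMap ℂ K v +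
      lusztigCoef (algebraMap ℂ K v) p * σ (lusztigCoef (algebraMap ℂ K v) p)) • x) :
    IsDemazureLusztig v σ p T := by
  refine ⟨hT, LinearMap.ext fun x => ?_⟩
  have hTI (x : M) : T x = intertwiner v p T x + lusztigCoef (algebraMap ℂ K v) p • x := by
    rw [intertwiner_apply, sub_add_cancel]
  simp only [Module.End.mul_apply, LinearMap.add_apply, LinearMap.smul_apply, Module.End.one_apply]
  rw [hTI (T x), hTI x, map_add, hI, intertwiner_smul_of_bernstein hT]
  simp only [← algebraMap_smul K v x, ← algebraMap_smul K (v - 1), map_sub, map_one]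
  set d := lusztigCoef (algebraMap ℂ K v) p
  rw [show σ d = algebraMap ℂ K v - 1 - d by rw [← hσ]; ring]
  module

theorem smul_add_smul_add_smul_add_smul {a b c d e : K} (h : b + c = 0) (h' : a + d = e)
    (x y : M) : a • x + b • y + (c • y + d • x) = e • x := by
  rw [← h', eq_neg_of_add_eq_zero_left h]
  module

theorem heckeFactor_tmul (T : Module.End ℂ M) (f : K) :
    heckeFactor ((1 : K) ⊗ₜ[ℂ] T) f = (1 : K) ⊗ₜ[ℂ] T - f ⊗ₜ[ℂ] 1 := by
  rw [heckeFactor, Algebra.TensorProduct.one_def, TensorProduct.smul_tmul', smul_eq_mul, mul_one]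

namespace IsDemazureLusztig

variable {v : ℂ} {σ τ : K →ₐ[ℂ] K} {p q : K} {T U : Module.End ℂ M}

theorem intertwiner_smul (hT : IsDemazureLusztig v σ p T) (f : K) (x : M) :
    intertwiner v p T (f • x) = σ f • intertwiner v p T x :=
  intertwiner_smul_of_bernstein hT.map_smul f x

theorem tmul_mul_self (hT : IsDemazureLusztig v σ p T) :
    ((1 : K) ⊗ₜ[ℂ] T) * ((1 : K) ⊗ₜ[ℂ] T) =
      (algebraMap ℂ K v - 1) • ((1 : K) ⊗ₜ[ℂ] T) + algebraMap ℂ K v • 1 := by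
  have e : algebraMap ℂ K v - 1 = algebraMap ℂ K (v - 1) := by simp
  rw [Algebra.TensorProduct.tmul_mul_tmul, mul_one, hT.mul_self, e, algebraMap_smul,
    algebraMap_smul, TensorProduct.tmul_add, TensorProduct.tmul_smul, TensorProduct.tmul_smul,
    Algebra.TensorProduct.one_def]

/-- On `M` the operators do not commute with `K`, whereas the Yang-Baxter identities need central
parameters. In `K ⊗ End M` the scalars are central. Applying an intertwiner there becomes left
multiplication by a factor `T - d`, after twisting the earlier parameters by `σ`. A composite of
intertwiners thus becomes a Yang-Baxter product. -/
theorem intertwiner_evalTensor (hT : IsDemazureLusztig v σ p T) (x : M)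
    (ξ : K ⊗[ℂ] Module.End ℂ M) :
    intertwiner v p T (evalTensor x ξ) =
      evalTensor x (heckeFactor ((1 : K) ⊗ₜ[ℂ] T) (lusztigCoef (algebraMap ℂ K v) p) *
        Algebra.TensorProduct.map σ (AlgHom.id ℂ (Module.End ℂ M)) ξ) := by
  induction ξ using TensorProduct.induction_on with
  | zero => simp
  | add a b ha hb => simp only [map_add, mul_add, ha, hb]
  | tmul f r =>
    rw [Algebra.TensorProduct.map_tmul, heckeFactor_tmul, sub_mul, Algebra.TensorProduct.tmul_mul_tmul, Algebra.TensorProduct.tmul_mul_tmul, map_sub,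
      evalTensor_tmul, evalTensor_tmul, evalTensor_tmul, hT.intertwiner_smul, intertwiner_apply]
    simp only [smul_sub, one_mul, AlgHom.id_apply, smul_smul, mul_comm,
      Module.End.mul_apply]

theorem map_heckeFactor (f : K) (T : Module.End ℂ M) :
    Algebra.TensorProduct.map σ (AlgHom.id ℂ (Module.End ℂ M)) (heckeFactor ((1 : K) ⊗ₜ[ℂ] T) f) =
      heckeFactor ((1 : K) ⊗ₜ[ℂ] T) (σ f) := by
  simp [heckeFactor_tmul]

theorem evalTensor_one (x : M) : evalTensor (K := K) x 1 = x := one_smul K x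

theorem intertwiner_eq_evalTensor (hT : IsDemazureLusztig v σ p T) (x : M) :
    intertwiner v p T x =
      evalTensor x (heckeFactor ((1 : K) ⊗ₜ[ℂ] T) (lusztigCoef (algebraMap ℂ K v) p)) := by
  conv_lhs => rw [← evalTensor_one (K := K) x, hT.intertwiner_evalTensor, map_one, mul_one]

theorem altProd_two (hT : IsDemazureLusztig v σ p T) (hU : IsDemazureLusztig v τ q U)
    (hσ : σ q = q) (hτ : τ p = p) :
    altProd 2 (intertwiner v p T) (intertwiner v q U) -
      altProd 2 (intertwiner v q U) (intertwiner v p T) = altProd 2 T U - altProd 2 U T := by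
  refine LinearMap.ext fun x => ?_
  simp only [altProd, mul_one, LinearMap.sub_apply, Module.End.mul_apply,
    hT.intertwiner_eq_evalTensor x, hU.intertwiner_evalTensor,
    hU.intertwiner_eq_evalTensor x, hT.intertwiner_evalTensor, map_heckeFactor,
    map_lusztigCoef, hσ, hτ]
  rw [← map_sub]
  exact (congrArg (evalTensor x) (yangBaxter_two _ _ _ _)).trans (by simp [evalTensor_tmul])

theorem altProd_three [CharZero K] (hT : IsDemazureLusztig v σ p T)
    (hU : IsDemazureLusztig v τ q U) (hσp : σ p = p⁻¹) (hτq : τ q = q⁻¹) (hσ : σ q = p * q)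
    (hτ : τ p = p * q) (h₁ : p - 1 ≠ 0) (h₂ : p * q - 1 ≠ 0) (h₃ : q - 1 ≠ 0) (hp : p ≠ 0)
    (hq : q ≠ 0) :
    altProd 3 (intertwiner v p T) (intertwiner v q U) -
      altProd 3 (intertwiner v q U) (intertwiner v p T) = altProd 3 T U - altProd 3 U T := by
  -- This is `σ (τ p) = q`: the twists accumulated along the word produce exactly the parameters of
  -- the Yang-Baxter product. The auxiliary equations in the longer cases play the same role.
  have e₁ : p⁻¹ * (p * q) = q := by field_simp
  have e₂ : p * q * q⁻¹ = p := by field_simp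
  refine LinearMap.ext fun x => ?_
  simp only [altProd, mul_one, LinearMap.sub_apply, Module.End.mul_apply,
    hT.intertwiner_eq_evalTensor x, hU.intertwiner_evalTensor,
    hU.intertwiner_eq_evalTensor x, hT.intertwiner_evalTensor, map_mul, map_heckeFactor,
    map_lusztigCoef, hσ, hτ, hσp, hτq, e₁, e₂]
  rw [← map_sub]
  exact (congrArg (evalTensor x) (yangBaxter_three hT.tmul_mul_self hU.tmul_mul_self h₁ h₂ h₃)).trans
    (by simp [evalTensor_tmul])

theorem altProd_four [CharZero K] (hT : IsDemazureLusztig v σ p T)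
    (hU : IsDemazureLusztig v τ q U) (hσp : σ p = p⁻¹) (hτq : τ q = q⁻¹) (hσ : σ q = p ^ 2 * q)
    (hτ : τ p = p * q) (h₁ : p - 1 ≠ 0) (h₂ : p ^ 2 * q - 1 ≠ 0) (h₃ : p * q - 1 ≠ 0)
    (h₄ : q - 1 ≠ 0) (hp : p ≠ 0) (hq : q ≠ 0) :
    altProd 4 (intertwiner v p T) (intertwiner v q U) -
      altProd 4 (intertwiner v q U) (intertwiner v p T) = altProd 4 T U - altProd 4 U T := by
  have e₁ : p⁻¹ * (p ^ 2 * q) = p * q := by field_simp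
  have e₂ : (p * q) ^ 2 * q⁻¹ = p ^ 2 * q := by field_simp
  have e₃ : p⁻¹ ^ 2 * (p ^ 2 * q) = q := by field_simp
  have e₄ : p * q * q⁻¹ = p := by field_simp
  refine LinearMap.ext fun x => ?_
  simp only [altProd, mul_one, LinearMap.sub_apply, Module.End.mul_apply,
    hT.intertwiner_eq_evalTensor x, hU.intertwiner_evalTensor,
    hU.intertwiner_eq_evalTensor x, hT.intertwiner_evalTensor, map_mul, map_heckeFactor,
    map_lusztigCoef, hσ, hτ, hσp, hτq, e₁, e₂, e₃, e₄, map_pow]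
  rw [← map_sub]
  exact (congrArg (evalTensor x) (yangBaxter_four hT.tmul_mul_self hU.tmul_mul_self h₁ h₂ h₃ h₄)).trans
    (by simp [evalTensor_tmul])

theorem altProd_six [CharZero K] (hT : IsDemazureLusztig v σ p T)
    (hU : IsDemazureLusztig v τ q U) (hσp : σ p = p⁻¹) (hτq : τ q = q⁻¹) (hσ : σ q = p ^ 3 * q)
    (hτ : τ p = p * q) (h₁ : p - 1 ≠ 0) (h₂ : p ^ 3 * q - 1 ≠ 0) (h₃ : p ^ 2 * q - 1 ≠ 0)
    (h₄ : p ^ 3 * q ^ 2 - 1 ≠ 0) (h₅ : p * q - 1 ≠ 0) (h₆ : q - 1 ≠ 0) (hp : p ≠ 0)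
    (hq : q ≠ 0) :
    altProd 6 (intertwiner v p T) (intertwiner v q U) -
      altProd 6 (intertwiner v q U) (intertwiner v p T) = altProd 6 T U - altProd 6 U T := by
  have e₁ : p⁻¹ * (p ^ 3 * q) = p ^ 2 * q := by field_simp
  have e₂ : (p * q) ^ 3 * q⁻¹ = p ^ 3 * q ^ 2 := by field_simp
  have e₃ : p⁻¹ ^ 3 * (p ^ 3 * q) ^ 2 = p ^ 3 * q ^ 2 := by field_simp
  have e₄ : (p * q) ^ 2 * q⁻¹ = p ^ 2 * q := by field_simp
  have e₅ : p⁻¹ ^ 2 * (p ^ 3 * q) = p * q := by field_simp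
  have e₆ : (p * q) ^ 3 * q⁻¹ ^ 2 = p ^ 3 * q := by field_simp
  have e₇ : p * q * q⁻¹ = p := by field_simp
  have e₈ : p⁻¹ ^ 3 * (p ^ 3 * q) = q := by field_simp
  refine LinearMap.ext fun x => ?_
  simp only [altProd, mul_one, LinearMap.sub_apply, Module.End.mul_apply,
    hT.intertwiner_eq_evalTensor x, hU.intertwiner_evalTensor,
    hU.intertwiner_eq_evalTensor x, hT.intertwiner_evalTensor, map_mul, map_heckeFactor,
    map_lusztigCoef, hσ, hτ, hσp, hτq, e₁, e₂, e₃, e₄, e₅, e₆, e₇, e₈, map_pow]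
  rw [← map_sub]
  exact (congrArg (evalTensor x) (yangBaxter_six hT.tmul_mul_self hU.tmul_mul_self h₁ h₂ h₃ h₄ h₅ h₆)).trans
    (by simp [evalTensor_tmul])

end IsDemazureLusztig
end Intertwiner

/-! ### Commuting the braid defect past a generator. -/

section Alternating

variable {R : Type*} [Ring R] [Algebra ℂ R]

/-- The kernel of the defect is therefore stable under the generators. The factor is `r = (v - 1) -
t'`, where `t'` is the conjugate of `t` by the longest element: `t` itself for even `m` and `u` for
`m = 3`. For `v ≠ 0` it equals `-v t'⁻¹`. -/
theorem exists_altProd_sub_altProd_mul {v : ℂ} {t u : R} (ht : t * t = (v - 1) • t + v • 1)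
    (hu : u * u = (v - 1) • u + v • 1) {m : ℕ} (hm : m = 2 ∨ m = 3 ∨ m = 4 ∨ m = 6) :
    ∃ r : R, (altProd m t u - altProd m u t) * t = r * (altProd m t u - altProd m u t) := by
  have ht' (x : R) : t * (t * x) = (v - 1) • (t * x) + v • x := by
    rw [← mul_assoc, ht, add_mul, smul_mul_assoc, smul_mul_assoc, one_mul]
  have hu' (x : R) : u * (u * x) = (v - 1) • (u * x) + v • x := by
    rw [← mul_assoc, hu, add_mul, smul_mul_assoc, smul_mul_assoc, one_mul]
  rcases hm with rfl | rfl | rfl | rfl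
  · refine ⟨(v - 1) • 1 - t, ?_⟩
    simp only [altProd, mul_one, sub_mul, mul_sub, mul_assoc, smul_mul_assoc, one_mul, ht, ht',
      mul_add, mul_smul_comm]
    module
  · refine ⟨(v - 1) • 1 - u, ?_⟩
    simp only [altProd, mul_one, sub_mul, mul_sub, mul_assoc, smul_mul_assoc, one_mul, ht, hu',
      mul_add, mul_smul_comm]
    module
  · refine ⟨(v - 1) • 1 - t, ?_⟩
    simp only [altProd, mul_one, sub_mul, mul_sub, mul_assoc, smul_mul_assoc, one_mul, ht, ht',
      mul_add, mul_smul_comm]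
    module
  · refine ⟨(v - 1) • 1 - t, ?_⟩
    simp only [altProd, mul_one, sub_mul, mul_sub, mul_assoc, smul_mul_assoc, one_mul, ht, ht',
      mul_add, mul_smul_comm]
    module

end Alternating

/-! ### Minimal weights in rank two and the orbit of a minimal weight. -/

section RankTwo

/-- A Weyl group invariant quadratic form in the pairings with two simple coroots. -/
def rankTwoForm (A k a b : ℤ) : ℤ := a ^ 2 - k * A * (a * b) + k * b ^ 2

/-- The quadratic form `rankTwoForm` is minimal at `(a, b)` on its coset modulo the lattice spanned
by the multiples `n₁ α` and `n₂ β` of the simple roots. -/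
def IsMinimalPair (A k n₁ n₂ a b : ℤ) : Prop :=
  ∀ s t : ℤ, rankTwoForm A k a b ≤
    rankTwoForm A k (a + 2 * (s * n₁) + t * n₂ * (k * A)) (b + s * n₁ * A + 2 * (t * n₂))

namespace IsMinimalPair

variable {A k n₁ n₂ a b : ℤ}

/-- Translating by `± n₁ α` changes the form by the positive factor `4 - k A²` times `n₁ (n₁ ± a)`,
which minimality forces to be nonnegative. -/
theorem abs_le_left (h : IsMinimalPair A k n₁ n₂ a b) (hn : 0 < n₁) (hk : k * A ^ 2 < 4) :
    -n₁ ≤ a ∧ a ≤ n₁ := by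
  have h₁ := h 1 0
  have h₂ := h (-1) 0
  have e (s : ℤ) : rankTwoForm A k (a + 2 * (s * n₁) + 0 * n₂ * (k * A))
      (b + s * n₁ * A + 2 * (0 * n₂)) =
      rankTwoForm A k a b + (4 - k * A ^ 2) * (n₁ * (s ^ 2 * n₁ + s * a)) := by
    unfold rankTwoForm; ring
  rw [e] at h₁ h₂
  have h₃ : 0 ≤ n₁ * (1 ^ 2 * n₁ + 1 * a) := by
    by_contra hc; nlinarith
  have h₄ : 0 ≤ n₁ * ((-1) ^ 2 * n₁ + -1 * a) := by
    by_contra hc; nlinarith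
  have h₅ := nonneg_of_mul_nonneg_right h₃ hn
  have h₆ := nonneg_of_mul_nonneg_right h₄ hn
  constructor <;> linarith

theorem abs_le_right (h : IsMinimalPair A k n₁ n₂ a b) (hn : 0 < n₂) (hk₀ : 0 < k)
    (hk : k * A ^ 2 < 4) : -n₂ ≤ b ∧ b ≤ n₂ := by
  have h₁ := h 0 1
  have h₂ := h 0 (-1)
  have e (s : ℤ) : rankTwoForm A k (a + 2 * (0 * n₁) + s * n₂ * (k * A))
      (b + 0 * n₁ * A + 2 * (s * n₂)) =
      rankTwoForm A k a b + k * (4 - k * A ^ 2) * (n₂ * (s ^ 2 * n₂ + s * b)) := by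
    unfold rankTwoForm; ring
  rw [e] at h₁ h₂
  have hp : 0 < k * (4 - k * A ^ 2) := mul_pos hk₀ (by linarith)
  have h₃ : 0 ≤ n₂ * (1 ^ 2 * n₂ + 1 * b) := by
    by_contra hc; nlinarith
  have h₄ : 0 ≤ n₂ * ((-1) ^ 2 * n₂ + -1 * b) := by
    by_contra hc; nlinarith
  have h₅ := nonneg_of_mul_nonneg_right h₃ hn
  have h₆ := nonneg_of_mul_nonneg_right h₄ hn
  constructor <;> linarith

/-- The reflection preserves the form. By the divisibility it also preserves the lattice spanned by
`n₁ α` and `n₂ β`. -/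
theorem reflect_left (h : IsMinimalPair A k n₁ n₂ a b) (hd : n₁ ∣ n₂ * (k * A)) :
    IsMinimalPair A k n₁ n₂ (-a) (b - a * A) := by
  intro s t
  obtain ⟨c, hc⟩ := hd
  have h₁ := h (-s - t * c) t
  have e₁ : rankTwoForm A k (-a) (b - a * A) = rankTwoForm A k a b := by
    unfold rankTwoForm; ring
  have e₂ : rankTwoForm A k (-a + 2 * (s * n₁) + t * n₂ * (k * A))
      (b - a * A + s * n₁ * A + 2 * (t * n₂)) =
      rankTwoForm A k (a + 2 * ((-s - t * c) * n₁) + t * n₂ * (k * A))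
        (b + (-s - t * c) * n₁ * A + 2 * (t * n₂)) := by
    have : (-s - t * c) * n₁ = -s * n₁ - t * (n₂ * (k * A)) := by rw [hc]; ring
    rw [this]
    unfold rankTwoForm; ring
  rw [e₁, e₂]; exact h₁

theorem reflect_right (h : IsMinimalPair A k n₁ n₂ a b) (hd : n₂ ∣ n₁ * A) :
    IsMinimalPair A k n₁ n₂ (a - b * (k * A)) (-b) := by
  intro s t
  obtain ⟨c, hc⟩ := hd
  have h₁ := h s (-t - s * c)
  have e₁ : rankTwoForm A k (a - b * (k * A)) (-b) = rankTwoForm A k a b := by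
    unfold rankTwoForm; ring
  have e₂ : rankTwoForm A k (a - b * (k * A) + 2 * (s * n₁) + t * n₂ * (k * A))
      (-b + s * n₁ * A + 2 * (t * n₂)) =
      rankTwoForm A k (a + 2 * (s * n₁) + (-t - s * c) * n₂ * (k * A))
        (b + s * n₁ * A + 2 * ((-t - s * c) * n₂)) := by
    have : (-t - s * c) * n₂ = -t * n₂ - s * (n₁ * A) := by rw [hc]; ring
    rw [this]
    unfold rankTwoForm; ring
  rw [e₁, e₂]; exact h₁

theorem rankTwoForm_nonneg (hk₀ : 0 < k) (hk : k * A ^ 2 < 4) (a b : ℤ) :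
    0 ≤ rankTwoForm A k a b := by
  have e : 4 * rankTwoForm A k a b = (2 * a - k * A * b) ^ 2 + k * (4 - k * A ^ 2) * b ^ 2 := by
    unfold rankTwoForm; ring
  have : 0 ≤ k * (4 - k * A ^ 2) * b ^ 2 :=
    mul_nonneg (mul_nonneg hk₀.le (by linarith)) (sq_nonneg b)
  nlinarith [sq_nonneg (2 * a - k * A * b)]

theorem exists_isMinimalPair (hk₀ : 0 < k) (hk : k * A ^ 2 < 4) (n₁ n₂ a b : ℤ) :
    ∃ s t : ℤ, IsMinimalPair A k n₁ n₂ (a + 2 * (s * n₁) + t * n₂ * (k * A))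
      (b + s * n₁ * A + 2 * (t * n₂)) := by
  let f : ℤ × ℤ → ℕ := fun p => (rankTwoForm A k (a + 2 * (p.1 * n₁) + p.2 * n₂ * (k * A))
      (b + p.1 * n₁ * A + 2 * (p.2 * n₂))).toNat
  refine ⟨(Function.argmin f).1, (Function.argmin f).2, fun s t => ?_⟩
  have h := Function.argmin_le f ((Function.argmin f).1 + s, (Function.argmin f).2 + t)
  have e₁ := rankTwoForm_nonneg hk₀ hk
    (a + 2 * (((Function.argmin f).1 + s) * n₁) + ((Function.argmin f).2 + t) * n₂ * (k * A))
    (b + ((Function.argmin f).1 + s) * n₁ * A + 2 * (((Function.argmin f).2 + t) * n₂))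
  refine ((Int.toNat_le.1 h).trans_eq (Int.toNat_of_nonneg e₁)).trans_eq ?_
  congr 1 <;> ring

end IsMinimalPair

/-- A family of vectors that is permuted, up to scalars, by two operators `T` and `U` in the way
in which two simple reflections permute the small weights. The integers `ℓ₁ μ` and `ℓ₂ μ` are the
pairings of `μ` with the simple coroots, up to a shift. -/
structure RankTwoOrbit {X M : Type*} [AddCommGroup X] [AddCommGroup M] [Module ℂ M]
    (T U : Module.End ℂ M) (w : X → M) (α β : X) (ℓ₁ ℓ₂ : X → ℤ) (A k n₁ n₂ : ℤ)
    (γ₁ γ₂ : ℤ → ℂ) : Prop where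
  left_sub_left (μ : X) (c : ℤ) : ℓ₁ (μ - c • α) = ℓ₁ μ - 2 * c
  right_sub_left (μ : X) (c : ℤ) : ℓ₂ (μ - c • α) = ℓ₂ μ - c * A
  left_sub_right (μ : X) (c : ℤ) : ℓ₁ (μ - c • β) = ℓ₁ μ - c * (k * A)
  right_sub_right (μ : X) (c : ℤ) : ℓ₂ (μ - c • β) = ℓ₂ μ - 2 * c
  left_apply (μ : X) : -n₁ ≤ ℓ₁ μ → ℓ₁ μ ≤ 0 → T (w μ) = γ₁ (ℓ₁ μ) • w (μ - ℓ₁ μ • α)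
  right_apply (μ : X) : -n₂ ≤ ℓ₂ μ → ℓ₂ μ ≤ 0 → U (w μ) = γ₂ (ℓ₂ μ) • w (μ - ℓ₂ μ • β)
  left_ne_zero (a : ℤ) : γ₁ a ≠ 0
  right_ne_zero (a : ℤ) : γ₂ a ≠ 0
  left_pos : 0 < n₁
  right_pos : 0 < n₂
  left_dvd : n₁ ∣ n₂ * (k * A)
  right_dvd : n₂ ∣ n₁ * A
  ratio_pos : 0 < k
  weight_lt : k * A ^ 2 < 4
  nonpos : A ≤ 0

namespace RankTwoOrbit

variable {X M : Type*} [AddCommGroup X] [AddCommGroup M] [Module ℂ M]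
    {T U : Module.End ℂ M} {w : X → M} {α β : X} {ℓ₁ ℓ₂ : X → ℤ} {A k n₁ n₂ : ℤ}
    {γ₁ γ₂ : ℤ → ℂ}

theorem left_step (h : RankTwoOrbit T U w α β ℓ₁ ℓ₂ A k n₁ n₂ γ₁ γ₂) {μ : X} {a b : ℤ}
    (ha : ℓ₁ μ = a) (hb : ℓ₂ μ = b) (hμ : IsMinimalPair A k n₁ n₂ a b) (ha₀ : a ≤ 0) :
    T (w μ) = γ₁ a • w (μ - a • α) ∧ ℓ₁ (μ - a • α) = -a ∧ ℓ₂ (μ - a • α) = b - a * A ∧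
      IsMinimalPair A k n₁ n₂ (-a) (b - a * A) := by
  subst ha hb
  refine ⟨h.left_apply μ (hμ.abs_le_left h.left_pos h.weight_lt).1 ha₀, ?_, ?_,
    hμ.reflect_left h.left_dvd⟩
  · rw [h.left_sub_left]; ring
  · rw [h.right_sub_left]

theorem right_step (h : RankTwoOrbit T U w α β ℓ₁ ℓ₂ A k n₁ n₂ γ₁ γ₂) {μ : X} {a b : ℤ}
    (ha : ℓ₁ μ = a) (hb : ℓ₂ μ = b) (hμ : IsMinimalPair A k n₁ n₂ a b) (hb₀ : b ≤ 0) :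
    U (w μ) = γ₂ b • w (μ - b • β) ∧ ℓ₁ (μ - b • β) = a - b * (k * A) ∧ ℓ₂ (μ - b • β) = -b ∧
      IsMinimalPair A k n₁ n₂ (a - b * (k * A)) (-b) := by
  subst ha hb
  refine ⟨h.right_apply μ (hμ.abs_le_right h.right_pos h.ratio_pos h.weight_lt).1 hb₀, ?_, ?_,
    hμ.reflect_right h.right_dvd⟩
  · rw [h.left_sub_right]
  · rw [h.right_sub_right]; ring

/-- Induction on a height. Reflecting a weight with a positive pairing `ℓ` gives a lower weight with
pairing `-ℓ`, from which `T` or `U` leads back up to an invertible scalar. The coefficients `2 - A`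
and `2 - k A` give both simple roots the same weight `4 - k A²`, so each such reflection lowers the
height by `ℓ (4 - k A²)`. The summands `n₁`, `n₂` make the height nonnegative on minimal weights. -/
theorem mem_of_isMinimalPair (h : RankTwoOrbit T U w α β ℓ₁ ℓ₂ A k n₁ n₂ γ₁ γ₂)
    (S : Submodule ℂ M) (hT : ∀ x ∈ S, T x ∈ S) (hU : ∀ x ∈ S, U x ∈ S)
    (hS : ∀ μ, IsMinimalPair A k n₁ n₂ (ℓ₁ μ) (ℓ₂ μ) → ℓ₁ μ ≤ 0 → ℓ₂ μ ≤ 0 → w μ ∈ S)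
    (N : ℕ) : ∀ μ, IsMinimalPair A k n₁ n₂ (ℓ₁ μ) (ℓ₂ μ) →
      (2 - A) * (ℓ₁ μ + n₁) + (2 - k * A) * (ℓ₂ μ + n₂) ≤ N → w μ ∈ S := by
  have hA : 0 < 2 - A := by linarith [h.nonpos]
  have hkA : 0 < 2 - k * A := by nlinarith [h.nonpos, h.ratio_pos]
  induction N using Nat.strong_induction_on with
  | _ N ih =>
  intro μ hμ hN
  have nonneg (μ : X) (hμ : IsMinimalPair A k n₁ n₂ (ℓ₁ μ) (ℓ₂ μ)) :
      0 ≤ (2 - A) * (ℓ₁ μ + n₁) + (2 - k * A) * (ℓ₂ μ + n₂) := by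
    have h₁ := (hμ.abs_le_left h.left_pos h.weight_lt).1
    have h₂ := (hμ.abs_le_right h.right_pos h.ratio_pos h.weight_lt).1
    exact add_nonneg (mul_nonneg hA.le (by linarith)) (mul_nonneg hkA.le (by linarith))
  by_cases ha : ℓ₁ μ ≤ 0
  · by_cases hb : ℓ₂ μ ≤ 0
    · exact hS μ hμ ha hb
    · push Not at hb
      have hμ' := hμ.reflect_right h.right_dvd
      set ν := μ - ℓ₂ μ • β with hν
      have h₁ : ℓ₁ ν = ℓ₁ μ - ℓ₂ μ * (k * A) := by rw [hν, h.left_sub_right]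
      have h₂ : ℓ₂ ν = -ℓ₂ μ := by rw [hν, h.right_sub_right]; ring
      rw [← h₁, ← h₂] at hμ'
      have hlt : (2 - A) * (ℓ₁ ν + n₁) + (2 - k * A) * (ℓ₂ ν + n₂) < N := by
        rw [h₁, h₂]
        nlinarith [mul_pos hb (show 0 < 4 - k * A ^ 2 by linarith [h.weight_lt])]
      have hmem := ih ((2 - A) * (ℓ₁ ν + n₁) + (2 - k * A) * (ℓ₂ ν + n₂)).toNat
        (by have := nonneg ν hμ'; omega) ν hμ' (Int.self_le_toNat _)
      have hap := (h.right_step rfl rfl hμ' (by rw [h₂]; linarith)).1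
      have e : ν - ℓ₂ ν • β = μ := by rw [h₂, hν]; module
      rw [e] at hap
      have := S.smul_mem (γ₂ (ℓ₂ ν))⁻¹ (hap ▸ hU _ hmem)
      rwa [smul_smul, inv_mul_cancel₀ (h.right_ne_zero _), one_smul] at this
  · push Not at ha
    have hμ' := hμ.reflect_left h.left_dvd
    set ν := μ - ℓ₁ μ • α with hν
    have h₁ : ℓ₁ ν = -ℓ₁ μ := by rw [hν, h.left_sub_left]; ring
    have h₂ : ℓ₂ ν = ℓ₂ μ - ℓ₁ μ * A := by rw [hν, h.right_sub_left]
    rw [← h₁, ← h₂] at hμ'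
    have hlt : (2 - A) * (ℓ₁ ν + n₁) + (2 - k * A) * (ℓ₂ ν + n₂) < N := by
      rw [h₁, h₂]
      nlinarith [mul_pos ha (show 0 < 4 - k * A ^ 2 by linarith [h.weight_lt])]
    have hmem := ih ((2 - A) * (ℓ₁ ν + n₁) + (2 - k * A) * (ℓ₂ ν + n₂)).toNat
      (by have := nonneg ν hμ'; omega) ν hμ' (Int.self_le_toNat _)
    have hap := (h.left_step rfl rfl hμ' (by rw [h₁]; linarith)).1
    have e : ν - ℓ₁ ν • α = μ := by rw [h₁, hν]; module
    rw [e] at hap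
    have := S.smul_mem (γ₁ (ℓ₁ ν))⁻¹ (hap ▸ hT _ hmem)
    rwa [smul_smul, inv_mul_cancel₀ (h.left_ne_zero _), one_smul] at this

theorem exists_mem (h : RankTwoOrbit T U w α β ℓ₁ ℓ₂ A k n₁ n₂ γ₁ γ₂)
    (S : Submodule ℂ M) (hT : ∀ x ∈ S, T x ∈ S) (hU : ∀ x ∈ S, U x ∈ S)
    (hS : ∀ μ, IsMinimalPair A k n₁ n₂ (ℓ₁ μ) (ℓ₂ μ) → ℓ₁ μ ≤ 0 → ℓ₂ μ ≤ 0 → w μ ∈ S)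
    (μ : X) : ∃ s t : ℤ, w (μ + (s • n₁ • α + t • n₂ • β)) ∈ S := by
  obtain ⟨s, t, hst⟩ :=
    IsMinimalPair.exists_isMinimalPair h.ratio_pos h.weight_lt n₁ n₂ (ℓ₁ μ) (ℓ₂ μ)
  refine ⟨s, t, h.mem_of_isMinimalPair S hT hU hS _ _ ?_ (Int.self_le_toNat _)⟩
  have e : μ + (s • n₁ • α + t • n₂ • β) = μ - (-(s * n₁)) • α - (-(t * n₂)) • β := by module
  convert hst using 1
  · rw [e, h.left_sub_right, h.left_sub_left]; ring
  · rw [e, h.right_sub_right, h.right_sub_left]; ring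

theorem altProd_two_apply (h : RankTwoOrbit T U w α β ℓ₁ ℓ₂ 0 k n₁ n₂ γ₁ γ₂) {μ : X}
    (hμ : IsMinimalPair 0 k n₁ n₂ (ℓ₁ μ) (ℓ₂ μ)) (ha : ℓ₁ μ ≤ 0) (hb : ℓ₂ μ ≤ 0) :
    altProd 2 T U (w μ) = altProd 2 U T (w μ) := by
  obtain ⟨p₁, q₁, r₁, s₁⟩ := h.left_step rfl rfl hμ ha
  obtain ⟨p₂, -, -, -⟩ := h.right_step q₁ r₁ s₁ (by linarith)
  obtain ⟨p₃, q₃, r₃, s₃⟩ := h.right_step rfl rfl hμ hb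
  obtain ⟨p₄, -, -, -⟩ := h.left_step q₃ r₃ s₃ (by linarith)
  simp only [altProd, mul_one, Module.End.mul_apply, p₁, p₂, p₃, p₄, map_smul, smul_smul]
  congr 1
  · ring_nf
  · congr 1; module

/-- Along either word the successive pairings are `a`, `a + b`, `b` in one order or the other, all
nonpositive, so every step is a monomial one. The middle pairing belongs to different simple
reflections in the two words, hence the need for a common scalar function `γ₁`. For `m = 4` and `m =
6` each pairing meets the same generator in both words. -/
theorem altProd_three_apply (h : RankTwoOrbit T U w α β ℓ₁ ℓ₂ (-1) 1 n₁ n₂ γ₁ γ₁) {μ : X}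
    (hμ : IsMinimalPair (-1) 1 n₁ n₂ (ℓ₁ μ) (ℓ₂ μ)) (ha : ℓ₁ μ ≤ 0) (hb : ℓ₂ μ ≤ 0) :
    altProd 3 T U (w μ) = altProd 3 U T (w μ) := by
  obtain ⟨p₁, q₁, r₁, s₁⟩ := h.left_step rfl rfl hμ ha
  obtain ⟨p₂, q₂, r₂, s₂⟩ := h.right_step q₁ r₁ s₁ (by linarith)
  obtain ⟨p₃, -, -, -⟩ := h.left_step q₂ r₂ s₂ (by linarith)
  obtain ⟨p₄, q₄, r₄, s₄⟩ := h.right_step rfl rfl hμ hb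
  obtain ⟨p₅, q₅, r₅, s₅⟩ := h.left_step q₄ r₄ s₄ (by linarith)
  obtain ⟨p₆, -, -, -⟩ := h.right_step q₅ r₅ s₅ (by linarith)
  simp only [altProd, mul_one, Module.End.mul_apply, p₁, p₂, p₃, p₄, p₅, p₆, map_smul, smul_smul]
  congr 1
  · ring_nf
  · congr 1; module

theorem altProd_four_apply (h : RankTwoOrbit T U w α β ℓ₁ ℓ₂ (-1) 2 n₁ n₂ γ₁ γ₂) {μ : X}
    (hμ : IsMinimalPair (-1) 2 n₁ n₂ (ℓ₁ μ) (ℓ₂ μ)) (ha : ℓ₁ μ ≤ 0) (hb : ℓ₂ μ ≤ 0) :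
    altProd 4 T U (w μ) = altProd 4 U T (w μ) := by
  obtain ⟨p₁, q₁, r₁, s₁⟩ := h.left_step rfl rfl hμ ha
  obtain ⟨p₂, q₂, r₂, s₂⟩ := h.right_step q₁ r₁ s₁ (by linarith)
  obtain ⟨p₃, q₃, r₃, s₃⟩ := h.left_step q₂ r₂ s₂ (by linarith)
  obtain ⟨p₄, -, -, -⟩ := h.right_step q₃ r₃ s₃ (by linarith)
  obtain ⟨p₅, q₅, r₅, s₅⟩ := h.right_step rfl rfl hμ hb
  obtain ⟨p₆, q₆, r₆, s₆⟩ := h.left_step q₅ r₅ s₅ (by linarith)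
  obtain ⟨p₇, q₇, r₇, s₇⟩ := h.right_step q₆ r₆ s₆ (by linarith)
  obtain ⟨p₈, -, -, -⟩ := h.left_step q₇ r₇ s₇ (by linarith)
  simp only [altProd, mul_one, Module.End.mul_apply, p₁, p₂, p₃, p₄, p₅, p₆, p₇, p₈, map_smul,
    smul_smul]
  congr 1
  · ring_nf
  · congr 1; module

theorem altProd_six_apply (h : RankTwoOrbit T U w α β ℓ₁ ℓ₂ (-1) 3 n₁ n₂ γ₁ γ₂) {μ : X}
    (hμ : IsMinimalPair (-1) 3 n₁ n₂ (ℓ₁ μ) (ℓ₂ μ)) (ha : ℓ₁ μ ≤ 0) (hb : ℓ₂ μ ≤ 0) :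
    altProd 6 T U (w μ) = altProd 6 U T (w μ) := by
  obtain ⟨p₁, q₁, r₁, s₁⟩ := h.left_step rfl rfl hμ ha
  obtain ⟨p₂, q₂, r₂, s₂⟩ := h.right_step q₁ r₁ s₁ (by linarith)
  obtain ⟨p₃, q₃, r₃, s₃⟩ := h.left_step q₂ r₂ s₂ (by linarith)
  obtain ⟨p₄, q₄, r₄, s₄⟩ := h.right_step q₃ r₃ s₃ (by linarith)
  obtain ⟨p₅, q₅, r₅, s₅⟩ := h.left_step q₄ r₄ s₄ (by linarith)
  obtain ⟨p₆, -, -, -⟩ := h.right_step q₅ r₅ s₅ (by linarith)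
  obtain ⟨p₇, q₇, r₇, s₇⟩ := h.right_step rfl rfl hμ hb
  obtain ⟨p₈, q₈, r₈, s₈⟩ := h.left_step q₇ r₇ s₇ (by linarith)
  obtain ⟨p₉, q₉, r₉, s₉⟩ := h.right_step q₈ r₈ s₈ (by linarith)
  obtain ⟨p₁₀, q₁₀, r₁₀, s₁₀⟩ := h.left_step q₉ r₉ s₉ (by linarith)
  obtain ⟨p₁₁, q₁₁, r₁₁, s₁₁⟩ := h.right_step q₁₀ r₁₀ s₁₀ (by linarith)
  obtain ⟨p₁₂, -, -, -⟩ := h.left_step q₁₁ r₁₁ s₁₁ (by linarith)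
  simp only [altProd, mul_one, Module.End.mul_apply, p₁, p₂, p₃, p₄, p₅, p₆, p₇, p₈, p₉, p₁₀, p₁₁,
    p₁₂, map_smul, smul_smul]
  congr 1
  · ring_nf
  · congr 1; module

end RankTwoOrbit
end RankTwo

/-! ### From rank two orbits to braid relations. -/

section Braid

variable {K M : Type*} [Field K] [Algebra ℂ K] [AddCommGroup M] [Module ℂ M] [Module K M]
  [IsScalarTower ℂ K M]

theorem altProd_intertwiner_smul {v : ℂ} {σ τ : K →ₐ[ℂ] K} {p q : K} {T U : Module.End ℂ M}
    (hT : IsDemazureLusztig v σ p T) (hU : IsDemazureLusztig v τ q U) (m : ℕ) (f : K) (x : M) :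
    altProd m (intertwiner v p T) (intertwiner v q U) (f • x) =
      altProd m σ τ f • altProd m (intertwiner v p T) (intertwiner v q U) x := by
  induction m generalizing σ τ p q T U with
  | zero => simp [altProd]
  | succ m ih =>
    simp only [altProd, Module.End.mul_apply, ih hU hT, hT.intertwiner_smul, AlgHom.mul_apply]

/-- The kernel `S` of the braid defect is a `K`-subspace stable under `T` and `U`. It contains a
translate of every `w μ`, hence a spanning set. -/
theorem altProd_eq_of_rankTwoOrbit {X : Type*} [AddCommGroup X] {v : ℂ} {σ τ : K →ₐ[ℂ] K}
    {p q : K} {T U : Module.End ℂ M} (hT : IsDemazureLusztig v σ p T)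
    (hU : IsDemazureLusztig v τ q U) {m : ℕ} (hm : m = 2 ∨ m = 3 ∨ m = 4 ∨ m = 6)
    (hστ : altProd m σ τ = altProd m τ σ)
    (hI : altProd m (intertwiner v p T) (intertwiner v q U) -
      altProd m (intertwiner v q U) (intertwiner v p T) = altProd m T U - altProd m U T)
    {w : X → M} {α β : X} {ℓ₁ ℓ₂ : X → ℤ} {A k n₁ n₂ : ℤ} {γ₁ γ₂ : ℤ → ℂ}
    (h : RankTwoOrbit T U w α β ℓ₁ ℓ₂ A k n₁ n₂ γ₁ γ₂)
    (hS : ∀ μ, IsMinimalPair A k n₁ n₂ (ℓ₁ μ) (ℓ₂ μ) → ℓ₁ μ ≤ 0 → ℓ₂ μ ≤ 0 →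
      altProd m T U (w μ) = altProd m U T (w μ))
    (hw : ∀ μ, ∀ s t : ℤ, ∃ c : K, w μ = c • w (μ + (s • n₁ • α + t • n₂ • β)))
    (hspan : Submodule.span K (Set.range w) = ⊤) :
    altProd m T U = altProd m U T := by
  let S : Submodule K M :=
    { carrier := {x | (altProd m T U - altProd m U T) x = 0}
      add_mem' := fun {a b} ha hb => by
        simp only [Set.mem_ofPred_eq] at ha hb ⊢
        rw [map_add, ha, hb, add_zero]
      zero_mem' := map_zero _
      smul_mem' := fun f x hx => by
        simp only [Set.mem_ofPred_eq] at hx ⊢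
        -- Only the intertwiner form of the defect is visibly semilinear: both of its terms carry
        -- the same automorphism, by `hστ`.
        rw [← hI, LinearMap.sub_apply] at hx ⊢
        rw [altProd_intertwiner_smul hT hU, altProd_intertwiner_smul hU hT, hστ, ← smul_sub, hx,
          smul_zero] }
  have hTS (x : M) (hx : x ∈ S.restrictScalars ℂ) : T x ∈ S.restrictScalars ℂ := by
    obtain ⟨r, hr⟩ := exists_altProd_sub_altProd_mul hT.mul_self hU.mul_self hm
    change (altProd m T U - altProd m U T) (T x) = 0
    rw [← Module.End.mul_apply, hr, Module.End.mul_apply, show _ = (0 : M) from hx, map_zero]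
  have hUS (x : M) (hx : x ∈ S.restrictScalars ℂ) : U x ∈ S.restrictScalars ℂ := by
    obtain ⟨r, hr⟩ := exists_altProd_sub_altProd_mul hU.mul_self hT.mul_self hm
    change (altProd m T U - altProd m U T) (U x) = 0
    rw [← neg_sub, LinearMap.neg_apply, ← Module.End.mul_apply, hr, Module.End.mul_apply, ← neg_sub,
      LinearMap.neg_apply, show _ = (0 : M) from hx, neg_zero, map_zero, neg_zero]
  have hmem (μ : X) : w μ ∈ S := by
    obtain ⟨s, t, hst⟩ := h.exists_mem (S.restrictScalars ℂ) hTS hUS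
      (fun μ h₁ h₂ h₃ => sub_eq_zero.2 (hS μ h₁ h₂ h₃)) μ
    obtain ⟨c, hc⟩ := hw μ s t
    rw [hc]
    exact S.smul_mem c hst
  have htop : S = ⊤ := top_le_iff.1 (hspan ▸ Submodule.span_le.2 (Set.range_subset_iff.2 hmem))
  refine sub_eq_zero.1 (LinearMap.ext fun x => ?_)
  exact (htop ▸ Submodule.mem_top : x ∈ S)

end Braid

noncomputable section

/-! ### Gauss sums: Hilbert symbols, values and reflection formula. -/

section GaussSum

variable {F : Type*} [Field F] [ValuativeRel F] [TopologicalSpace F] [IsNonarchimedeanLocalField F]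

theorem dvd_card_residueField_sub_one {n : ℕ} (hn : Nat.card 𝓀[F] ≡ 1 [MOD 2 * n]) :
    2 * n ∣ Nat.card 𝓀[F] - 1 :=
  (Nat.modEq_iff_dvd' (Finite.one_lt_card (α := 𝓀[F])).le).1 hn.symm

theorem natCast_residueField_ne_zero {n : ℕ} (hn : Nat.card 𝓀[F] ≡ 1 [MOD 2 * n]) :
    (n : 𝓀[F]) ≠ 0 := by
  intro h
  let _ : Fintype 𝓀[F] := Fintype.ofFinite _
  have h1 : ((Nat.card 𝓀[F] - 1 : ℕ) : 𝓀[F]) = 0 := by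
    obtain ⟨c, hc⟩ := dvd_card_residueField_sub_one hn
    rw [hc, Nat.cast_mul, Nat.cast_mul, h, mul_zero, zero_mul]
  rw [Nat.cast_sub (Finite.one_lt_card (α := 𝓀[F])).le, Nat.card_eq_fintype_card,
    FiniteField.cast_card_eq_zero] at h1
  simp at h1

/-- In `x^n - 1 = (1 + x + ⋯ + x^(n-1)) (x - 1)` the first factor has residue `n`, which is nonzero.
-/
theorem eq_one_of_pow_eq_one_of_residue_eq_one {n : ℕ} (hn : Nat.card 𝓀[F] ≡ 1 [MOD 2 * n])
    {x : 𝒪[F]} (hx : x ^ n = 1) (hr : IsLocalRing.residue 𝒪[F] x = 1) : x = 1 := by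
  have h : (∑ i ∈ Finset.range n, x ^ i) * (x - 1) = 0 := by rw [geom_sum_mul, hx, sub_self]
  refine sub_eq_zero.1 ((mul_eq_zero.1 h).resolve_left fun h0 => ?_)
  have := congrArg (IsLocalRing.residue 𝒪[F]) h0
  simp only [map_sum, map_pow, hr, one_pow, Finset.sum_const, Finset.card_range, nsmul_eq_mul,
    mul_one, map_zero] at this
  exact natCast_residueField_ne_zero hn this

theorem rootsOfUnity_eq_of_residue_eq {n : ℕ} (hn : Nat.card 𝓀[F] ≡ 1 [MOD 2 * n])
    {ζ ξ : rootsOfUnity n F} {x y : 𝒪[F]} (hx : (x : F) = ((ζ : Fˣ) : F))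
    (hy : (y : F) = ((ξ : Fˣ) : F))
    (h : IsLocalRing.residue 𝒪[F] x = IsLocalRing.residue 𝒪[F] y) : ζ = ξ := by
  have hpow (z : 𝒪[F]) (θ : rootsOfUnity n F) (hz : (z : F) = ((θ : Fˣ) : F)) : z ^ n = 1 := by
    have h1 : (((θ : Fˣ) ^ n : Fˣ) : F) = 1 := by
      rw [(mem_rootsOfUnity n (θ : Fˣ)).1 θ.2, Units.val_one]
    exact Subtype.ext (by simpa [hz] using h1)
  have hx1 := hpow x ζ hx
  have hy1 := hpow y ξ hy
  have hn0 : n ≠ 0 := by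
    rintro rfl
    exact natCast_residueField_ne_zero hn (by simp)
  have hyy : y * y ^ (n - 1) = 1 := by rw [mul_pow_sub_one hn0, hy1]
  have key : x * y ^ (n - 1) = 1 := by
    refine eq_one_of_pow_eq_one_of_residue_eq_one hn ?_ ?_
    · rw [mul_pow, hx1, one_mul, ← pow_mul, mul_comm, pow_mul, hy1, one_pow]
    · rw [map_mul, h, ← map_mul, hyy, map_one]
  have hxy : x = y := by
    calc x = x * y ^ (n - 1) * y := by rw [mul_assoc, mul_comm _ y, hyy, mul_one]
      _ = y := by rw [key, one_mul]
  apply Subtype.ext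
  apply Units.ext
  rw [← hx, ← hy, hxy]

theorem unitHilbertSymbol_spec {n : ℕ} (hn : Nat.card 𝓀[F] ≡ 1 [MOD 2 * n]) (t : 𝓀[F]ˣ) :
    ∃ x : 𝒪[F], (x : F) = ((unitHilbertSymbol hn t : Fˣ) : F) ∧
      IsLocalRing.residue 𝒪[F] x = (t : 𝓀[F]) ^ ((Nat.card 𝓀[F] - 1) / n) :=
  (exists_rootOfUnity_lift hn t).choose_spec

/-- The Hilbert symbol with a uniformizer, as a character of the residue field. -/
def hilbertHom {n : ℕ} (hn : Nat.card 𝓀[F] ≡ 1 [MOD 2 * n]) : 𝓀[F]ˣ →* rootsOfUnity n F :=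
  MonoidHom.mk' (unitHilbertSymbol hn) fun s t => by
    obtain ⟨x, hx, hx'⟩ := unitHilbertSymbol_spec hn s
    obtain ⟨y, hy, hy'⟩ := unitHilbertSymbol_spec hn t
    obtain ⟨z, hz, hz'⟩ := unitHilbertSymbol_spec hn (s * t)
    refine rootsOfUnity_eq_of_residue_eq hn hz (y := x * y) ?_ ?_
    · simp [hx, hy]
    · rw [hz', map_mul, hx', hy', Units.val_mul, mul_pow]

/-- This is where the congruence modulo `2 n`, rather than `n`, matters: the exponent `(q - 1) / n`
is even. It removes the sign `χ(-1)` from the product of two Gauss sums. -/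
theorem hilbertHom_neg_one {n : ℕ} (hn : Nat.card 𝓀[F] ≡ 1 [MOD 2 * n]) :
    hilbertHom hn (-1) = 1 := by
  obtain ⟨x, hx, hx'⟩ := unitHilbertSymbol_spec hn (-1)
  refine rootsOfUnity_eq_of_residue_eq hn hx (y := 1) (by simp) ?_
  obtain ⟨c, hc⟩ := dvd_card_residueField_sub_one hn
  have hn0 : 0 < n := by
    rcases Nat.eq_zero_or_pos n with rfl | h
    · exact absurd (by simp) (natCast_residueField_ne_zero hn)
    · exact h
  have e : (Nat.card 𝓀[F] - 1) / n = 2 * c := by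
    rw [hc, mul_comm 2 n, mul_assoc, Nat.mul_div_cancel_left _ hn0]
  rw [hx', e, pow_mul]
  simp

/-- For a generator `t` of the cyclic group of the residue field, `t^((q - 1) / n)` has order
exactly `n`. So the character in the Gauss sum is nontrivial whenever `n ∤ a`. -/
theorem exists_dvd_of_hilbertHom_zpow_eq_one {n : ℕ} (hn : Nat.card 𝓀[F] ≡ 1 [MOD 2 * n]) :
    ∃ t : 𝓀[F]ˣ, ∀ a : ℤ, hilbertHom hn t ^ a = 1 → (n : ℤ) ∣ a := by
  obtain ⟨t, ht⟩ := IsCyclic.exists_ofOrder_eq_natCard (α := 𝓀[F]ˣ)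
  rw [Nat.card_units] at ht
  refine ⟨t, fun a ha => ?_⟩
  refine (Int.natCast_dvd_natCast.2 ?_).trans (orderOf_dvd_iff_zpow_eq_one.2 ha)
  set k := orderOf (hilbertHom hn t) with hk
  obtain ⟨x, hx, hx'⟩ := unitHilbertSymbol_spec hn t
  change (x : F) = ((hilbertHom hn t : Fˣ) : F) at hx
  have h1 : hilbertHom hn t ^ k = 1 := pow_orderOf_eq_one _
  have h2 : x ^ k = 1 := by
    have h3 : (((hilbertHom hn t ^ k : rootsOfUnity n F) : Fˣ) : F) = 1 := by rw [h1]; simp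
    exact Subtype.ext (by simpa [hx] using h3)
  have h4 : (t : 𝓀[F]) ^ ((Nat.card 𝓀[F] - 1) / n * k) = 1 := by
    rw [pow_mul, ← hx', ← map_pow, h2, map_one]
  have h5 : t ^ ((Nat.card 𝓀[F] - 1) / n * k) = 1 := Units.ext (by simpa using h4)
  have h6 := orderOf_dvd_of_pow_eq_one h5
  rw [ht] at h6
  have hdvd : n ∣ Nat.card 𝓀[F] - 1 := (Dvd.intro_left 2 rfl).trans (dvd_card_residueField_sub_one hn)
  obtain ⟨c, hc⟩ := hdvd
  have hq1 : 1 < Nat.card 𝓀[F] := Finite.one_lt_card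
  have hn0 : 0 < n := by
    rcases Nat.eq_zero_or_pos n with rfl | h
    · omega
    · exact h
  have hc0 : 0 < c := by
    rcases Nat.eq_zero_or_pos c with rfl | h
    · omega
    · exact h
  rw [hc, Nat.mul_div_cancel_left _ hn0, mul_comm n c] at h6
  exact Nat.dvd_of_mul_dvd_mul_left hc0 h6

theorem addChar_div_eq_of_residue_eq {ϖ : 𝒪[F]} (hϖ : Irreducible ϖ) {ψ : AddChar F ℂ}
    (hψ : ∀ x : 𝒪[F], ψ (x : F) = 1) {x y : 𝒪[F]}
    (h : IsLocalRing.residue 𝒪[F] x = IsLocalRing.residue 𝒪[F] y) :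
    ψ ((x : F) / (ϖ : F)) = ψ ((y : F) / (ϖ : F)) := by
  have hmem : x - y ∈ IsLocalRing.maximalIdeal 𝒪[F] := by
    rw [← IsLocalRing.residue_eq_zero_iff, map_sub, h, sub_self]
  rw [hϖ.maximalIdeal_eq, Ideal.mem_span_singleton] at hmem
  obtain ⟨z, hz⟩ := hmem
  have hϖ0 : (ϖ : F) ≠ 0 := fun h0 => hϖ.ne_zero (Subtype.ext h0)
  have e : (x : F) / (ϖ : F) = (z : F) + (y : F) / (ϖ : F) := by
    have : (x : F) = (ϖ : F) * z + y := by
      rw [sub_eq_iff_eq_add] at hz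
      rw [hz]; simp
    rw [this]; field_simp
  rw [e, AddChar.map_add_eq_mul, hψ, one_mul]

/-- The additive character of the residue field given by `x ↦ ψ (x / ϖ)`. -/
def residueAddChar {ϖ : 𝒪[F]} (hϖ : Irreducible ϖ) {ψ : AddChar F ℂ}
    (hψ : ∀ x : 𝒪[F], ψ (x : F) = 1) : AddChar 𝓀[F] ℂ where
  toFun t := ψ ((residueLift t : F) / (ϖ : F))
  map_zero_eq_one' := by
    rw [addChar_div_eq_of_residue_eq hϖ hψ (y := 0)]
    · simp
    · rw [map_zero]; exact Function.surjInv_eq _ _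
  map_add_eq_mul' s t := by
    rw [addChar_div_eq_of_residue_eq hϖ hψ (y := residueLift s + residueLift t)]
    · rw [← AddChar.map_add_eq_mul]; congr 1; push_cast; ring
    · rw [map_add]; simp only [residueLift, Function.surjInv_eq]

theorem residueAddChar_ne_one {ϖ : 𝒪[F]} (hϖ : Irreducible ϖ) {ψ : AddChar F ℂ}
    (hψ : ∀ x : 𝒪[F], ψ (x : F) = 1) (hψ' : ∃ x : 𝒪[F], ψ ((x : F) / (ϖ : F)) ≠ 1) :
    residueAddChar hϖ hψ ≠ 1 := by
  obtain ⟨x, hx⟩ := hψ'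
  intro h
  apply hx
  rw [addChar_div_eq_of_residue_eq hϖ hψ (y := residueLift (IsLocalRing.residue 𝒪[F] x))]
  · exact DFunLike.congr_fun h _
  · exact (Function.surjInv_eq _ _).symm

theorem metaplecticGaussSum_eq [Fintype 𝓀[F]] {n : ℕ} (hn : Nat.card 𝓀[F] ≡ 1 [MOD 2 * n])
    {ϖ : 𝒪[F]} (hϖ : Irreducible ϖ) (ε : rootsOfUnity n F →* ℂˣ) {ψ : AddChar F ℂ}
    (hψ : ∀ x : 𝒪[F], ψ (x : F) = 1) (a : ℤ) :
    metaplecticGaussSum hn ϖ ε ψ a =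
      localV F * gaussSum (MulChar.ofUnitHom (ε.comp (hilbertHom hn) ^ a))
        (residueAddChar hϖ hψ) := by
  classical
  rw [metaplecticGaussSum, finsum_eq_sum_of_fintype, gaussSum]
  congr 1
  refine Fintype.sum_of_injective (fun t : 𝓀[F]ˣ => (t : 𝓀[F])) Units.val_injective _ _ ?_ ?_
  · intro t ht
    have h0 : ¬ IsUnit t := fun h => ht ⟨h.unit, rfl⟩
    rw [MulChar.map_nonunit _ h0, zero_mul]
  · intro t
    rw [MulChar.ofUnitHom_coe]
    rfl

theorem localV_mul_card : localV F * (Nat.card 𝓀[F] : ℂ) = 1 :=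
  inv_mul_cancel₀ (Nat.cast_ne_zero.2 Nat.card_pos.ne')

theorem metaplecticGaussSum_of_dvd {n : ℕ} (hn : Nat.card 𝓀[F] ≡ 1 [MOD 2 * n])
    {ϖ : 𝒪[F]} (hϖ : Irreducible ϖ) (ε : rootsOfUnity n F →* ℂˣ) {ψ : AddChar F ℂ}
    (hψ : ∀ x : 𝒪[F], ψ (x : F) = 1) (hψ' : ∃ x : 𝒪[F], ψ ((x : F) / (ϖ : F)) ≠ 1) {a : ℤ}
    (ha : (n : ℤ) ∣ a) : metaplecticGaussSum hn ϖ ε ψ a = -localV F := by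
  let _ : Fintype 𝓀[F] := Fintype.ofFinite _
  have e : ε.comp (hilbertHom hn) ^ a = 1 := by
    obtain ⟨c, rfl⟩ := ha
    ext t
    have h : hilbertHom hn t ^ (n : ℤ) = 1 := by
      rw [zpow_natCast]
      exact Subtype.ext ((mem_rootsOfUnity n _).1 (hilbertHom hn t).2)
    rw [MonoidHom.zpow_apply, MonoidHom.comp_apply, ← map_zpow, zpow_mul, h, one_zpow, map_one]
    rfl
  have e' : MulChar.ofUnitHom (1 : 𝓀[F]ˣ →* ℂˣ) = 1 := by ext; simp
  rw [metaplecticGaussSum_eq hn hϖ ε hψ, e, e', gaussSum_one_left (residueAddChar_ne_one hϖ hψ hψ'),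
    mul_neg_one]

theorem metaplecticGaussSum_mul_neg {n : ℕ} (hn : Nat.card 𝓀[F] ≡ 1 [MOD 2 * n])
    {ϖ : 𝒪[F]} (hϖ : Irreducible ϖ) {ε : rootsOfUnity n F →* ℂˣ} (hε : Function.Injective ε)
    {ψ : AddChar F ℂ} (hψ : ∀ x : 𝒪[F], ψ (x : F) = 1)
    (hψ' : ∃ x : 𝒪[F], ψ ((x : F) / (ϖ : F)) ≠ 1) {a : ℤ} (ha : ¬ (n : ℤ) ∣ a) :
    metaplecticGaussSum hn ϖ ε ψ a * metaplecticGaussSum hn ϖ ε ψ (-a) = localV F := by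
  let _ : Fintype 𝓀[F] := Fintype.ofFinite _
  set χ : MulChar 𝓀[F] ℂ := MulChar.ofUnitHom (ε.comp (hilbertHom hn) ^ a) with hχ
  have hinv : MulChar.ofUnitHom (ε.comp (hilbertHom hn) ^ (-a)) = χ⁻¹ := by
    rw [eq_inv_iff_mul_eq_one]
    ext t
    simp [hχ, inv_mul_cancel₀ (zpow_ne_zero a (Units.ne_zero (ε (hilbertHom hn t))))]
  have hχ1 : χ ≠ 1 := by
    intro h
    obtain ⟨t, ht⟩ := exists_dvd_of_hilbertHom_zpow_eq_one hn
    refine ha (ht a (hε ?_))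
    have h1 : χ t = 1 := by rw [h, MulChar.one_apply_coe]
    rw [hχ, MulChar.ofUnitHom_coe] at h1
    rw [map_one, map_zpow]
    exact Units.ext h1
  have hneg : χ⁻¹ (-1) = 1 := by
    have h1 := MulChar.ofUnitHom_coe (ε.comp (hilbertHom hn) ^ (-a)) (-1)
    rw [hinv] at h1
    simpa [hilbertHom_neg_one] using h1
  have h := gaussSum_mul_gaussSum_eq_card hχ1
    (AddChar.IsPrimitive.of_ne_one (residueAddChar_ne_one hϖ hψ hψ'))
  have h2 := mul_gaussSum_inv_eq_gaussSum χ⁻¹ (residueAddChar hϖ hψ)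
  rw [hneg, one_mul] at h2
  rw [metaplecticGaussSum_eq hn hϖ ε hψ, metaplecticGaussSum_eq hn hϖ ε hψ, ← hχ, hinv]
  rw [h2, ← Nat.card_eq_fintype_card] at h
  -- The product of the unnormalised sums is `q`, and `v² q = v`.
  linear_combination (localV F) ^ 2 * h + localV F * localV_mul_card (F := F)

theorem metaplecticGaussSum_congr {n : ℕ} (hn : Nat.card 𝓀[F] ≡ 1 [MOD 2 * n])
    (ϖ : 𝒪[F]) (ε : rootsOfUnity n F →* ℂˣ) (ψ : AddChar F ℂ) {a b : ℤ}
    (hab : (n : ℤ) ∣ a - b) :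
    metaplecticGaussSum hn ϖ ε ψ a = metaplecticGaussSum hn ϖ ε ψ b := by
  have e (t : 𝓀[F]ˣ) : ε (unitHilbertSymbol hn t) ^ a = ε (unitHilbertSymbol hn t) ^ b := by
    obtain ⟨c, hc⟩ := hab
    have h : unitHilbertSymbol hn t ^ (n : ℤ) = 1 := by
      rw [zpow_natCast]
      exact Subtype.ext ((mem_rootsOfUnity n _).1 (unitHilbertSymbol hn t).2)
    rw [← map_zpow, ← map_zpow, show a = n * c + b by linarith, zpow_add, zpow_mul, h, one_zpow,
      one_mul]
  simp only [metaplecticGaussSum, e]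

end GaussSum

/-! ### Monomials in the field of rational functions. -/

section Monomials

variable {X : Type*} [AddCommGroup X]

theorem zMon_add (μ ν : X) : zMon (μ + ν) = zMon μ * zMon ν := by
  rw [zMon, zMon, zMon, ← map_mul, AddMonoidAlgebra.single_mul_single, one_mul]

theorem zMon_zero : zMon (0 : X) = 1 := map_one _

theorem zMon_mul_zMon_neg (μ : X) : zMon μ * zMon (-μ) = 1 := by
  rw [← zMon_add, add_neg_cancel, zMon_zero]

theorem zMon_injective : Function.Injective (zMon : X → LatticeRatFun X) := by
  intro μ ν h
  have h1 := IsFractionRing.injective (AddMonoidAlgebra ℂ X) (LatticeRatFun X) h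
  exact AddMonoidAlgebra.single_left_injective one_ne_zero h1

theorem ratFunAut_zMon (w : X ≃+ X) (μ : X) : ratFunAut w (zMon μ) = zMon (w μ) := by
  rw [ratFunAut, zMon, IsFractionRing.algEquivOfAlgEquiv_algebraMap, zMon]
  congr 1
  simp

variable [Module.Free ℤ X]

theorem zMon_ne_zero (μ : X) : zMon μ ≠ 0 := left_ne_zero_of_mul_eq_one (zMon_mul_zMon_neg μ)

theorem zMon_neg (μ : X) : zMon (-μ) = (zMon μ)⁻¹ :=
  eq_inv_of_mul_eq_one_right (zMon_mul_zMon_neg μ)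

theorem zMon_zsmul (c : ℤ) (μ : X) : zMon (c • μ) = zMon μ ^ c := by
  induction c with
  | zero => simp [zMon_zero]
  | succ c ih => rw [add_smul, one_smul, zMon_add, ih, zpow_add_one₀ (zMon_ne_zero μ)]
  | pred c ih =>
    rw [sub_smul, one_smul, sub_eq_add_neg, zMon_add, ih, zpow_sub_one₀ (zMon_ne_zero μ), zMon_neg]

theorem zMon_sub_one_ne_zero {μ : X} (hμ : μ ≠ 0) : zMon μ - 1 ≠ 0 := by
  rw [sub_ne_zero, ← zMon_zero]
  exact fun h => hμ (zMon_injective h)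

theorem LatticeRatFun.algHom_ext {σ τ : LatticeRatFun X →ₐ[ℂ] LatticeRatFun X}
    (h : ∀ μ, σ (zMon μ) = τ (zMon μ)) : σ = τ := by
  apply IsLocalization.algHom_ext (nonZeroDivisors (AddMonoidAlgebra ℂ X))
  exact AddMonoidAlgebra.algHom_ext (fun μ => h μ) (Subsingleton.elim _ _)

end Monomials

/-- The properties of the Gauss sums that the Hecke relations use. -/
structure IsGaussSumFamily (n : ℕ) (v : ℂ) (g : ℤ → ℂ) : Prop where
  ne_zero : v ≠ 0
  of_dvd (a : ℤ) : (n : ℤ) ∣ a → g a = -v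
  mul_neg (a : ℤ) : ¬ (n : ℤ) ∣ a → g a * g (-a) = v
  congr (a b : ℤ) : (n : ℤ) ∣ a - b → g a = g b

theorem IsGaussSumFamily.apply_ne_zero {n : ℕ} {v : ℂ} {g : ℤ → ℂ} (hg : IsGaussSumFamily n v g)
    (a : ℤ) : g a ≠ 0 := by
  by_cases h : (n : ℤ) ∣ a
  · rw [hg.of_dvd a h]; exact neg_ne_zero.2 hg.ne_zero
  · exact left_ne_zero_of_mul (hg.mul_neg a h ▸ hg.ne_zero)

/-! ### Arithmetic of the bilinear form and of classes modulo `Λ^(n)`. -/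

namespace MetaplecticDatum

variable {ι X Y : Type*} [AddCommGroup X] [AddCommGroup Y] (D : MetaplecticDatum ι X Y)

/-- The pairing with a simple coroot. -/
def cr (i : D.Simple) : X →ₗ[ℤ] ℤ := D.P.coroot' i

theorem s_apply (i : D.Simple) (μ : X) : D.s i μ = μ - D.cr i μ • D.α i :=
  D.P.reflection_apply i μ

theorem cr_α_self (i : D.Simple) : D.cr i (D.α i) = 2 := D.P.root_coroot'_eq_pairing i i ▸
  D.P.pairing_same i

theorem two_mul_Q (i : D.Simple) : 2 * D.Q (D.α i) = D.B (D.α i) (D.α i) := by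
  obtain ⟨q, hq⟩ := D.even (D.α i) (Submodule.subset_span ⟨_, rfl⟩)
  rw [Q, hq]; omega

/-- Follows from invariance under `s_i`, applied to the pair `α_i`, `μ`. It makes the division by
`Q(α_i)` in the operators exact. -/
theorem B_α (i : D.Simple) (μ : X) : D.B (D.α i) μ = D.Q (D.α i) * D.cr i μ := by
  have h := D.invariant i (D.α i) μ
  change D.B (D.s i _) (D.s i _) = _ at h
  simp only [s_apply, cr_α_self, map_sub, map_smul, LinearMap.sub_apply, LinearMap.smul_apply,
    smul_eq_mul] at h
  refine mul_left_cancel₀ (two_ne_zero (α := ℤ)) ?_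
  linear_combination (-1) * h - D.cr i μ * D.two_mul_Q i

theorem nn_pos (i : D.Simple) : 0 < D.nn i := by
  refine Nat.div_pos (Nat.le_of_dvd D.n_pos ?_) (Int.gcd_pos_of_ne_zero_left _ ?_)
  · exact_mod_cast Int.gcd_dvd_left (D.n : ℤ) (D.Q (D.α i))
  · exact_mod_cast D.n_pos.ne'

/-- Dividing by `gcd(n, Q(α_i))` leaves `n_i` coprime to the remaining factor of `Q(α_i)`. With
`B_α` this translates congruences modulo `n` for `B` into congruences modulo `n_i` for coroot
pairings. -/
theorem dvd_Q_mul_iff (i : D.Simple) (a : ℤ) :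
    (D.n : ℤ) ∣ D.Q (D.α i) * a ↔ (D.nn i : ℤ) ∣ a := by
  have hn : (D.n : ℤ) ≠ 0 := by exact_mod_cast D.n_pos.ne'
  have e : (D.nn i : ℤ) = D.n / (Int.gcd D.n (D.Q (D.α i)) : ℤ) := by rw [nn]; simp
  set q := D.Q (D.α i)
  set d : ℤ := (Int.gcd D.n q : ℤ) with hd
  have hd0 : d ≠ 0 := by
    have := Int.gcd_pos_of_ne_zero_left q hn
    omega
  obtain ⟨x, hx⟩ : d ∣ (D.n : ℤ) := Int.gcd_dvd_left _ _
  obtain ⟨y, hy⟩ : d ∣ q := Int.gcd_dvd_right _ _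
  have hcop : IsCoprime x y := by
    rw [Int.isCoprime_iff_gcd_eq_one]
    have h1 : Int.gcd (d * x) (d * y) = d.natAbs := by rw [← hx, ← hy, hd]; simp
    rw [Int.gcd_mul_left] at h1
    exact Nat.eq_of_mul_eq_mul_left (Int.natAbs_pos.2 hd0) (by rw [h1, mul_one])
  rw [e, hx, hy, Int.mul_ediv_cancel_left _ hd0, mul_assoc, mul_dvd_mul_iff_left hd0]
  exact ⟨fun h => hcop.dvd_of_dvd_mul_left h, fun h => h.mul_left y⟩

theorem nn_dvd_cr (i : D.Simple) {ν : X} (hν : ν ∈ D.Λn) : (D.nn i : ℤ) ∣ D.cr i ν := by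
  rw [← D.dvd_Q_mul_iff, ← B_α]
  exact hν _

theorem zsmul_α_mem (i : D.Simple) {a : ℤ} (h : (D.nn i : ℤ) ∣ a) : a • D.α i ∈ D.Λn := by
  obtain ⟨c, rfl⟩ := h
  rw [mul_comm, mul_smul]
  exact D.Λn.zsmul_mem (D.nn_smul_mem i) c

section Rep

variable {D} {Γ : Set X} (hΓ : D.IsRepSystem Γ)

theorem sub_rep_mem (μ : X) : μ - (D.rep hΓ μ : X) ∈ D.Λn := (hΓ μ).choose_spec.1

theorem rep_eq_iff {μ : X} {γ : Γ} : D.rep hΓ μ = γ ↔ μ - (γ : X) ∈ D.Λn := by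
  refine ⟨fun h => h ▸ sub_rep_mem hΓ μ, fun h => ?_⟩
  exact ((hΓ μ).choose_spec.2 γ h).symm

theorem rep_eq_rep_iff {μ ν : X} : D.rep hΓ μ = D.rep hΓ ν ↔ μ - ν ∈ D.Λn := by
  rw [rep_eq_iff]
  have e : μ - (D.rep hΓ ν : X) = (μ - ν) + (ν - D.rep hΓ ν) := by abel
  rw [e]
  exact D.Λn.add_mem_cancel_right (sub_rep_mem hΓ ν)

theorem rep_coe (γ : Γ) : D.rep hΓ (γ : X) = γ := by
  rw [rep_eq_iff, sub_self]; exact D.Λn.zero_mem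

/-- The shifted reflection `μ ↦ s_i μ + α_i` is an involution that respects classes modulo `Λ^(n)`.
-/
theorem s_add_α_sub_mem_iff (i : D.Simple) (μ ν : X) :
    D.s i μ + D.α i - ν ∈ D.Λn ↔ μ - (D.s i ν + D.α i) ∈ D.Λn := by
  have hs (x : X) : D.s i (D.s i x) = x := by simp [s]
  have hα : D.s i (D.α i) = -D.α i := by simp [s, α]
  constructor <;> intro h
  · have := D.s_mem i h
    simp only [map_sub, map_add, hs, hα] at this
    convert this using 1
    abel
  · have := D.s_mem i h
    simp only [map_sub, map_add, hs, hα] at this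
    convert this using 1
    abel

/-- `Λ^(n)` contains `n Λ`, so a class is determined by coordinates modulo `n`. -/
theorem finite_repSystem [Module.Free ℤ X] [Module.Finite ℤ X] (hΓ : D.IsRepSystem Γ) : Finite Γ := by
  let b := Module.Free.chooseBasis ℤ X
  have : NeZero D.n := ⟨D.n_pos.ne'⟩
  refine Finite.of_injective
    (fun (γ : Γ) (k : Module.Free.ChooseBasisIndex ℤ X) => ((b.repr (γ : X) k : ℤ) : ZMod D.n)) ?_
  intro γ δ h
  rw [← rep_coe hΓ γ, rep_eq_iff]
  intro y
  have hc (k) : (D.n : ℤ) ∣ b.repr ((γ : X) - δ) k := by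
    have := congrFun h k
    simp only [ZMod.intCast_eq_intCast_iff_dvd_sub] at this
    rw [map_sub, Finsupp.sub_apply, ← neg_sub, dvd_neg]
    exact this
  rw [← b.sum_repr ((γ : X) - δ), map_sum]
  refine Finset.dvd_sum fun k _ => ?_
  rw [map_smul, smul_eq_mul]
  exact (hc k).mul_right _

end Rep

end MetaplecticDatum

/-! ### The operators on the vectors `z^(-μ) e_μ`, and the quadratic relation. -/

namespace MetaplecticDatum

variable {ι X Y : Type*} [AddCommGroup X] [AddCommGroup Y] [Module.Free ℤ X]
  {D : MetaplecticDatum ι X Y} {Γ : Set X} (hΓ : D.IsRepSystem Γ) {v : ℂ} {g : ℤ → ℂ}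

theorem sRat_zMon (i : D.Simple) (μ : X) : D.sRat i (zMon μ) = zMon (D.s i μ) :=
  ratFunAut_zMon _ _

theorem α_ne_zero (i : D.Simple) : D.α i ≠ 0 := by
  intro h
  have := D.cr_α_self i
  rw [h, map_zero] at this
  norm_num at this

/-- The monomial `z ^ (n_i α_i)`. -/
def Z (i : D.Simple) : LatticeRatFun X := zMon ((D.nn i : ℤ) • D.α i)

theorem Z_ne_zero (i : D.Simple) : Z i ≠ 0 := zMon_ne_zero _

theorem Z_sub_one_ne_zero (i : D.Simple) : Z i - 1 ≠ 0 := by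
  refine zMon_sub_one_ne_zero (smul_ne_zero ?_ (α_ne_zero i))
  exact_mod_cast (D.nn_pos i).ne'

theorem Z_zpow (i : D.Simple) (c : ℤ) : Z i ^ c = zMon ((c * D.nn i) • D.α i) := by
  rw [Z, ← zMon_zsmul, smul_smul]

theorem s_α_self (i : D.Simple) : D.s i (D.α i) = -D.α i := by simp [s, α]

theorem sRat_Z (i : D.Simple) : D.sRat i (Z i) = (Z i)⁻¹ := by
  rw [Z, sRat_zMon, map_smul, s_α_self, smul_neg, zMon_neg]

theorem Dcoef_eq (v : ℂ) (i : D.Simple) :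
    D.Dcoef v i = lusztigCoef (algebraMap ℂ (LatticeRatFun X) v) (Z i) := by
  rw [Dcoef, lusztigCoef, Z, map_sub, map_one]

theorem Dcoef_mul (v : ℂ) (i : D.Simple) :
    D.Dcoef v i * (Z i - 1) = 1 - algebraMap ℂ (LatticeRatFun X) v := by
  rw [Dcoef_eq, lusztigCoef, div_mul_cancel₀ _ (Z_sub_one_ne_zero i)]

theorem sRat_Dcoef (v : ℂ) (i : D.Simple) : D.sRat i (D.Dcoef v i) = -(Z i * D.Dcoef v i) := by
  have h₁ := Z_sub_one_ne_zero i
  have h₂ := Z_ne_zero i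
  have h₃ : (Z i)⁻¹ - 1 ≠ 0 := by
    intro h
    apply h₁
    rw [sub_eq_zero, inv_eq_one] at h
    rw [h, sub_self]
  have e := congrArg (D.sRat i) (Dcoef_mul v i)
  rw [map_mul, map_sub, map_sub, map_one, sRat_Z, AlgEquiv.commutes] at e
  have e' := Dcoef_mul v i
  have : (D.sRat i (D.Dcoef v i) + Z i * D.Dcoef v i) * ((Z i)⁻¹ - 1) = 0 := by
    rw [add_mul, e, ← e']
    field_simp
    ring
  exact eq_neg_of_add_eq_zero_left ((mul_eq_zero.1 this).resolve_right h₃)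

theorem demazure_apply (i : D.Simple) (f : Γ → LatticeRatFun X) (γ : Γ) :
    D.demazure v g hΓ i f γ = D.Dcoef v i * f γ + D.sRat i (D.τ v g hΓ i f γ) := rfl

theorem τ_apply (i : D.Simple) (f : Γ → LatticeRatFun X) (γ : Γ) :
    D.τ v g hΓ i f γ =
      D.τ₁ v i γ * f γ + D.τ₂ g i γ * f (D.rep hΓ (D.s i γ + D.α i)) := rfl

theorem demazure_smul (i : D.Simple) (k : LatticeRatFun X) (f : Γ → LatticeRatFun X) :
    D.demazure v g hΓ i (k • f) = (D.sRat i : LatticeRatFun X →ₐ[ℂ] LatticeRatFun X) k •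
      D.demazure v g hΓ i f + (lusztigCoef (algebraMap ℂ (LatticeRatFun X) v) (Z i) *
        (k - (D.sRat i : LatticeRatFun X →ₐ[ℂ] LatticeRatFun X) k)) • f := by
  rw [← Dcoef_eq]
  funext γ
  simp only [Pi.add_apply, Pi.smul_apply, smul_eq_mul, demazure_apply, τ_apply, map_add, map_mul,
    AlgEquiv.coe_toAlgHom]
  ring

/-- The intertwiner `s_i τ` of the simple reflection `s_i`. -/
abbrev inter (v : ℂ) (g : ℤ → ℂ) (i : D.Simple) : Module.End ℂ (Γ → LatticeRatFun X) :=
  intertwiner v (Z i) (D.demazure v g hΓ i)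

theorem inter_smul (i : D.Simple) (k : LatticeRatFun X) (f : Γ → LatticeRatFun X) :
    inter hΓ v g i (k • f) = D.sRat i k • inter hΓ v g i f :=
  intertwiner_smul_of_bernstein (demazure_smul hΓ i) k f

theorem demazure_eq (i : D.Simple) (f : Γ → LatticeRatFun X) :
    D.demazure v g hΓ i f = inter hΓ v g i f + D.Dcoef v i • f := by
  rw [intertwiner_apply, Dcoef_eq, sub_add_cancel]

theorem inter_apply (i : D.Simple) (f : Γ → LatticeRatFun X) (γ : Γ) :
    inter hΓ v g i f γ = D.sRat i (D.τ v g hΓ i f γ) := by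
  rw [intertwiner_apply, Pi.sub_apply, demazure_apply, Dcoef_eq, Pi.smul_apply, smul_eq_mul,
    add_sub_cancel_left]

open Classical in
/-- The vector `z ^ (-μ) e_μ`. -/
def vec (μ : X) : Γ → LatticeRatFun X := Pi.single (D.rep hΓ μ) (zMon (-μ))

theorem vec_apply_of_eq {μ : X} {γ : Γ} (h : D.rep hΓ μ = γ) : vec hΓ μ γ = zMon (-μ) := by
  classical
  subst h; exact Pi.single_eq_same _ _

theorem vec_apply_of_ne {μ : X} {γ : Γ} (h : D.rep hΓ μ ≠ γ) : vec hΓ μ γ = 0 := by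
  classical
  exact Pi.single_eq_of_ne h.symm _

theorem vec_add (μ : X) {ν : X} (hν : ν ∈ D.Λn) :
    vec hΓ (μ + ν) = zMon (-ν) • vec hΓ μ := by
  have h : D.rep hΓ (μ + ν) = D.rep hΓ μ := by
    rw [rep_eq_rep_iff, add_sub_cancel_left]; exact hν
  funext γ
  rw [Pi.smul_apply, smul_eq_mul]
  by_cases hγ : D.rep hΓ μ = γ
  · rw [vec_apply_of_eq hΓ hγ, vec_apply_of_eq hΓ (h.trans hγ), neg_add_rev, zMon_add]
  · rw [vec_apply_of_ne hΓ hγ, vec_apply_of_ne hΓ (h ▸ hγ), mul_zero]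

theorem span_range_vec [Module.Finite ℤ X] :
    Submodule.span (LatticeRatFun X) (Set.range (vec (Γ := Γ) hΓ)) = ⊤ := by
  classical
  have := finite_repSystem hΓ
  have := Fintype.ofFinite Γ
  refine top_le_iff.1 fun f _ => ?_
  have e : f = ∑ γ : Γ, (f γ * zMon (γ : X)) • vec hΓ (γ : X) := by
    funext δ
    rw [Finset.sum_apply, Finset.sum_eq_single δ]
    · rw [Pi.smul_apply, vec_apply_of_eq hΓ (rep_coe hΓ δ), smul_eq_mul, mul_assoc,
        zMon_mul_zMon_neg, mul_one]
    · intro γ _ hγ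
      rw [Pi.smul_apply, vec_apply_of_ne hΓ (by rwa [rep_coe]), smul_zero]
    · intro h; exact absurd (Finset.mem_univ _) h
  rw [e]
  exact Submodule.sum_mem _ fun γ _ =>
    Submodule.smul_mem _ _ (Submodule.subset_span (Set.mem_range_self _))

/-- The shifted pairing `⟨μ, α_i^∨⟩ - 1`. -/
def ell (i : D.Simple) (μ : X) : ℤ := D.cr i μ - 1

theorem s_add_α (i : D.Simple) (μ : X) : D.s i μ + D.α i = μ - ell i μ • D.α i := by
  rw [s_apply, ell]; module

/-- Both sides are the least multiple of `n_i` that is at least `c`. With `c = ℓ + 1` this turns the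
residue in `τ₁` into the floor of `ℓ / n_i`. -/
theorem residue_add (i : D.Simple) (c : ℤ) :
    (-c) % (D.nn i : ℤ) + c = ((c - 1) / D.nn i + 1) * D.nn i := by
  have hn : (0 : ℤ) < D.nn i := by exact_mod_cast D.nn_pos i
  generalize (D.nn i : ℤ) = n at hn ⊢
  have h₁ := Int.emod_add_mul_ediv (-c) n
  have h₂ := Int.emod_add_mul_ediv (c - 1) n
  have h₃ := Int.emod_nonneg (-c) hn.ne'
  have h₄ := Int.emod_lt_of_pos (-c) hn
  have h₅ := Int.emod_nonneg (c - 1) hn.ne'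
  have h₆ := Int.emod_lt_of_pos (c - 1) hn
  have h₇ : (-c) / n + ((c - 1) / n + 1) = 0 := by
    have e : n * ((-c) / n + ((c - 1) / n + 1)) = n - 1 - (-c) % n - (c - 1) % n := by
      linear_combination h₁ + h₂
    have lo : -1 < (-c) / n + ((c - 1) / n + 1) := by
      by_contra hc; nlinarith
    have hi : (-c) / n + ((c - 1) / n + 1) < 1 := by
      by_contra hc; nlinarith
    omega
  linear_combination h₁ - n * h₇

theorem residue_eq (i : D.Simple) {μ γ : X} (h : μ - γ ∈ D.Λn) :
    (-(D.B (D.α i) γ / D.Q (D.α i))) % (D.nn i : ℤ) = (-D.cr i μ) % (D.nn i : ℤ) := by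
  -- When `Q(α_i)` vanishes, `n_i = 1`, so both residues are zero whatever the quotient means.
  by_cases hQ : D.Q (D.α i) = 0
  · have h1 : D.nn i = 1 := by
      rw [nn, hQ]; simp [Nat.div_self D.n_pos]
    simp [h1]
  · rw [B_α, Int.mul_ediv_cancel_left _ hQ]
    refine Int.ModEq.neg ?_
    have := D.nn_dvd_cr i h
    rw [map_sub] at this
    exact Int.modEq_iff_dvd.2 this

/-- Scaling `e_μ` by `z^(-μ)` absorbs the dependence on the representative: the first term comes
from `τ₁` and stays in the class of `μ`, the second comes from `τ₂` and lies in the class of `s_i μ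
+ α_i`. -/
theorem inter_vec (hg : IsGaussSumFamily D.n v g) (i : D.Simple) (μ : X) :
    inter hΓ v g i (vec hΓ μ) =
      -(D.Dcoef v i * Z i ^ (ell i μ / D.nn i + 1)) • vec hΓ μ +
        g (D.Q (D.α i) * ell i μ) • vec hΓ (μ - ell i μ • D.α i) := by
  funext γ
  rw [inter_apply, τ_apply, map_add, Pi.add_apply]
  congr 1
  · by_cases hγ : γ = D.rep hΓ μ
    · subst hγ
      rw [Pi.smul_apply, vec_apply_of_eq hΓ rfl, smul_eq_mul, τ₁,
        residue_eq i (sub_rep_mem hΓ μ), map_mul, map_mul, sRat_zMon, sRat_zMon]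
      have e₁ : D.sRat i (algebraMap ℂ (LatticeRatFun X) (1 - v) /
          (1 - zMon (-((D.nn i : ℤ) • D.α i)))) = -D.Dcoef v i := by
        rw [map_div₀, AlgEquiv.commutes, map_sub, map_sub, map_one, map_one, sRat_zMon,
          map_neg, map_smul, s_α_self, smul_neg, neg_neg, Dcoef, ← neg_sub (zMon _) 1, div_neg, map_sub, map_one]
      rw [e₁, Z_zpow, neg_mul, neg_mul, neg_mul, mul_assoc, mul_assoc, ← zMon_add, ← zMon_add]
      congr 3
      rw [ell, ← residue_add, map_neg, map_smul, s_α_self, map_neg, s_apply]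
      module
    · rw [Pi.smul_apply, vec_apply_of_ne hΓ (Ne.symm hγ), mul_zero, map_zero, smul_zero]
  · rw [← s_add_α, Pi.smul_apply]
    by_cases hγ : γ = D.rep hΓ (D.s i μ + D.α i)
    · have h : D.s i μ + D.α i - (γ : X) ∈ D.Λn := by rw [hγ]; exact sub_rep_mem hΓ _
      have h' : D.rep hΓ (D.s i γ + D.α i) = D.rep hΓ μ := by
        rw [rep_eq_rep_iff, ← neg_mem_iff, neg_sub, ← s_add_α_sub_mem_iff]
        exact h
      have hgg : g (D.Q (D.α i) - D.B (D.α i) γ) = g (D.Q (D.α i) * ell i μ) := by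
        refine hg.congr _ _ ?_
        have h2 := h (D.α i)
        rw [map_sub, map_add, B_α D i (D.α i), B_α D i (D.s i μ), s_apply, map_sub, map_smul,
          cr_α_self] at h2
        convert h2 using 1
        rw [ell, smul_eq_mul]
        ring
      rw [vec_apply_of_eq hΓ h'.symm, vec_apply_of_eq hΓ hγ.symm, τ₂, hgg, map_mul, map_mul,
        AlgEquiv.commutes, sRat_zMon, sRat_zMon, s_α_self, mul_assoc, ← zMon_add,
        Algebra.smul_def, map_neg]
      congr 2
      abel
    · have h' : D.rep hΓ μ ≠ D.rep hΓ (D.s i γ + D.α i) := by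
        intro h
        apply hγ
        rw [rep_eq_rep_iff, ← s_add_α_sub_mem_iff] at h
        exact ((rep_eq_iff hΓ).2 h).symm
      rw [vec_apply_of_ne hΓ h', vec_apply_of_ne hΓ (Ne.symm hγ), mul_zero, map_zero, smul_zero]

theorem ell_sub_zsmul (i : D.Simple) (μ x : X) (c : ℤ) :
    ell i (μ - c • x) = ell i μ - c * D.cr i x := by
  rw [ell, ell, map_sub, map_smul, smul_eq_mul]; ring

theorem inter_inter_vec (hg : IsGaussSumFamily D.n v g) (i : D.Simple) (μ : X) :
    inter hΓ v g i (inter hΓ v g i (vec hΓ μ)) =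
      (algebraMap ℂ _ v + D.Dcoef v i * D.sRat i (D.Dcoef v i)) • vec hΓ μ := by
  have hn : (D.nn i : ℤ) ≠ 0 := by exact_mod_cast (D.nn_pos i).ne'
  have hZ := Z_ne_zero i
  set ℓ := ell i μ with hℓ
  have hℓ' : ell i (μ - ℓ • D.α i) = -ℓ := by
    rw [ell_sub_zsmul, cr_α_self]; ring
  have hμ : μ - ℓ • D.α i - (-ℓ) • D.α i = μ := by module
  rw [inter_vec hΓ hg, ← hℓ, map_add, inter_smul, map_smul, inter_vec hΓ hg, inter_vec hΓ hg, hℓ',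
    hμ, ← hℓ, map_neg, map_mul, map_zpow₀, sRat_Z, sRat_Dcoef]
  set d := D.Dcoef v i with hd
  have hdZ : d * (Z i - 1) = 1 - algebraMap ℂ (LatticeRatFun X) v := Dcoef_mul v i
  simp only [← algebraMap_smul (LatticeRatFun X) (g _)]
  -- If `n_i ∣ ℓ`, the two vectors are proportional over `K` and the Gauss sums are `-v`, leaving
  -- one scalar identity. Otherwise the mixed terms cancel because the exponents of `Z_i` match, and
  -- the Gauss sums multiply to `v`.
  by_cases hdvd : (D.nn i : ℤ) ∣ ℓ
  · have hQ := (D.dvd_Q_mul_iff i ℓ).2 hdvd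
    have hQ' : (D.n : ℤ) ∣ D.Q (D.α i) * -ℓ := by rw [mul_neg]; exact hQ.neg_right
    obtain ⟨t, ht⟩ := hdvd
    rw [hg.of_dvd _ hQ, hg.of_dvd _ hQ']
    have e₃ : -(t * (D.nn i : ℤ)) / (D.nn i : ℤ) = -t := by
      rw [← neg_mul, Int.mul_ediv_cancel _ hn]
    have e₁ : μ - ℓ • D.α i = μ + (-ℓ) • D.α i := by module
    rw [e₁, vec_add hΓ μ (D.zsmul_α_mem i (by rw [ht]; exact (dvd_mul_right _ _).neg_right)),
      ← neg_smul (-ℓ), neg_neg, show ℓ = t * D.nn i by rw [ht, mul_comm], ← Z_zpow,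
      Int.mul_ediv_cancel _ hn, e₃]
    simp only [smul_smul, map_neg, ← add_smul]
    congr 1
    rw [zpow_add₀ hZ, zpow_add₀ hZ, zpow_neg, zpow_one, inv_zpow, zpow_add₀ hZ, zpow_one]
    have hZt : Z i ^ t ≠ 0 := zpow_ne_zero t hZ
    field_simp
    linear_combination (algebraMap ℂ (LatticeRatFun X) v) * hdZ
  · have hQ := fun h => hdvd ((D.dvd_Q_mul_iff i ℓ).1 h)
    have hgg := hg.mul_neg _ hQ
    have hk : (-ℓ) / (D.nn i : ℤ) + 1 = -(ℓ / (D.nn i : ℤ)) := by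
      rw [Int.neg_ediv, if_neg hdvd, Int.sign_eq_one_of_pos (by exact_mod_cast D.nn_pos i)]; ring
    rw [hk]
    simp only [smul_add, smul_smul]
    have e₂ : algebraMap ℂ (LatticeRatFun X) v =
        algebraMap ℂ _ (g (D.Q (D.α i) * ℓ)) * algebraMap ℂ _ (g (D.Q (D.α i) * -ℓ)) := by
      rw [← map_mul, mul_neg, hgg]
    rw [e₂, inv_zpow, zpow_neg, zpow_add₀ hZ, zpow_one]
    have hZt : Z i ^ (ℓ / (D.nn i : ℤ)) ≠ 0 := zpow_ne_zero _ hZ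
    refine smul_add_smul_add_smul_add_smul ?_ ?_ _ _
    · field_simp; ring
    · field_simp; ring

theorem inter_inter [Module.Finite ℤ X] (hg : IsGaussSumFamily D.n v g) (i : D.Simple)
    (f : Γ → LatticeRatFun X) :
    inter hΓ v g i (inter hΓ v g i f) =
      (algebraMap ℂ _ v + D.Dcoef v i * D.sRat i (D.Dcoef v i)) • f := by
  have hs (k : LatticeRatFun X) : D.sRat i (D.sRat i k) = k := by
    have h : ((D.sRat i : LatticeRatFun X →ₐ[ℂ] LatticeRatFun X).comp
        (D.sRat i : LatticeRatFun X →ₐ[ℂ] LatticeRatFun X)) = AlgHom.id ℂ _ := by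
      apply LatticeRatFun.algHom_ext
      intro μ
      simp [sRat_zMon, s]
    exact DFunLike.congr_fun h k
  have hf : f ∈ Submodule.span (LatticeRatFun X) (Set.range (vec (Γ := Γ) hΓ)) := by
    rw [span_range_vec]; exact Submodule.mem_top
  induction hf using Submodule.span_induction with
  | mem x hx => obtain ⟨μ, rfl⟩ := hx; exact inter_inter_vec hΓ hg i μ
  | zero => simp
  | add x y _ _ hx hy => rw [map_add, map_add, hx, hy, smul_add]
  | smul k x _ hx => rw [inter_smul, inter_smul, hs, hx, smul_comm]

theorem isDemazureLusztig_demazure [Module.Finite ℤ X] (hg : IsGaussSumFamily D.n v g)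
    (i : D.Simple) :
    IsDemazureLusztig v (D.sRat i : LatticeRatFun X →ₐ[ℂ] LatticeRatFun X) (Z i)
      (D.demazure v g hΓ i) := by
  refine .of_intertwiner (demazure_smul hΓ i) ?_ fun f => ?_
  · rw [← Dcoef_eq, AlgEquiv.coe_toAlgHom, sRat_Dcoef]
    linear_combination -Dcoef_mul (D := D) v i
  · rw [← Dcoef_eq]
    exact inter_inter hΓ hg i f

/-- The scalar by which `T_i` permutes small weights. -/
def smallCoef (g : ℤ → ℂ) (q ℓ : ℤ) : ℂ := if ℓ = 0 then -1 else g (q * ℓ)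

theorem smallCoef_ne_zero (hg : IsGaussSumFamily D.n v g) (q ℓ : ℤ) : smallCoef g q ℓ ≠ 0 := by
  unfold smallCoef
  split_ifs
  · norm_num
  · exact hg.apply_ne_zero _

theorem demazure_vec (hg : IsGaussSumFamily D.n v g) (i : D.Simple) (μ : X)
    (h₁ : -(D.nn i : ℤ) ≤ ell i μ) (h₂ : ell i μ ≤ 0) :
    D.demazure v g hΓ i (vec hΓ μ) =
      smallCoef g (D.Q (D.α i)) (ell i μ) • vec hΓ (μ - ell i μ • D.α i) := by
  rw [demazure_eq, inter_vec hΓ hg]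
  by_cases h : ell i μ = 0
  -- At `ℓ = 0` the weight is fixed and the scalar is `d - d Z - v = -1`, not `g(0) = -v`.
  · rw [smallCoef, if_pos h, h, mul_zero, hg.of_dvd 0 (dvd_zero _), zero_smul, sub_zero,
      Int.zero_ediv, zero_add, zpow_one]
    have hd := Dcoef_mul (D := D) v i
    have e : algebraMap ℂ (LatticeRatFun X) v = 1 - D.Dcoef v i * (Z i - 1) := by rw [hd]; ring
    simp only [← algebraMap_smul (LatticeRatFun X) (_ : ℂ) (vec hΓ μ), map_neg, map_one, e,
      ← add_smul]
    congr 1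
    ring
  -- For `-n_i ≤ ℓ < 0` the power of `Z_i` is trivial, so the diagonal term `-d` of the intertwiner
  -- cancels the Demazure coefficient.
  · have hk : ell i μ / (D.nn i : ℤ) + 1 = 0 := by
      have hn : (0 : ℤ) < D.nn i := by exact_mod_cast D.nn_pos i
      have : ell i μ / (D.nn i : ℤ) = -1 := by
        rw [Int.ediv_eq_iff_of_pos hn]
        constructor <;> omega
      omega
    rw [smallCoef, if_neg h, hk, zpow_zero, mul_one, neg_smul,
      neg_add_eq_sub, sub_add_cancel]

end MetaplecticDatum

namespace MetaplecticDatum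

/-! ### Rank two Cartan matrices and the orders `m_ij`. -/

section Reflections

variable {ι X Y : Type*} [AddCommGroup X] [AddCommGroup Y] {D : MetaplecticDatum ι X Y}
  {i j : D.Simple}

theorem s_apply_sub_left (x : X) (a b : ℤ) :
    D.s i (x - a • D.α i - b • D.α j) =
      x - (D.cr i x - b * D.cr i (D.α j) - a) • D.α i - b • D.α j := by
  rw [s_apply, map_sub, map_sub, map_smul, map_smul, cr_α_self, smul_eq_mul, smul_eq_mul]
  module

theorem s_apply_sub_right (x : X) (a b : ℤ) :
    D.s j (x - a • D.α i - b • D.α j) =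
      x - a • D.α i - (D.cr j x - a * D.cr j (D.α i) - b) • D.α j := by
  rw [s_apply, map_sub, map_sub, map_smul, map_smul, cr_α_self, smul_eq_mul, smul_eq_mul]
  module

theorem smul_α_add_smul_α_eq_zero (hij : i ≠ j) {a b : ℤ} (h : a • D.α i + b • D.α j = 0) :
    a = 0 ∧ b = 0 :=
  LinearIndependent.pair_iff.1 (D.base.linearIndependent_pair_of_ne hij) a b h

theorem Q_mul_cr (i j : D.Simple) :
    D.Q (D.α i) * D.cr i (D.α j) = D.Q (D.α j) * D.cr j (D.α i) := by
  rw [← B_α, ← B_α, D.symm]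

theorem nn_dvd (i j : D.Simple) : (D.nn i : ℤ) ∣ D.nn j * D.cr i (D.α j) := by
  rw [← D.dvd_Q_mul_iff, mul_left_comm, Q_mul_cr, ← mul_assoc, mul_comm (D.nn j : ℤ)]
  exact ((D.dvd_Q_mul_iff j _).2 dvd_rfl).mul_right _

/-- Read backwards, this puts a vector into the normal form on which `s_apply_sub_left` and
`s_apply_sub_right` compute words in the reflections. -/
theorem sub_zero_smul_sub_zero_smul (x α β : X) : x - (0 : ℤ) • α - (0 : ℤ) • β = x := by simp

theorem s_mul_s_pow_apply_eq (u w : ℤ) (k : ℕ) (hij : i ≠ j)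
    (h : ((D.s i * D.s j) ^ k) (D.α i) = D.α i - u • D.α i - w • D.α j) (hu : u ≠ 0 ∨ w ≠ 0) :
    (D.s i * D.s j) ^ k ≠ 1 := by
  intro h1
  rw [h1] at h
  have h2 : u • D.α i + w • D.α j = 0 := by
    rw [LinearEquiv.coe_one, id] at h
    rw [sub_sub, eq_comm, sub_eq_self] at h
    exact h
  have := smul_α_add_smul_α_eq_zero hij h2
  omega

theorem m_eq_two (hij : i ≠ j) (hA : D.cr j (D.α i) = 0) (hA' : D.cr i (D.α j) = 0) :
    D.m i j = 2 := by
  refine orderOf_eq_of_pow_and_pow_div_prime (by norm_num) (LinearEquiv.ext fun x => ?_) ?_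
  · rw [← sub_zero_smul_sub_zero_smul x (D.α i) (D.α j)]
    simp only [pow_succ, pow_zero, one_mul, LinearEquiv.mul_apply, s_apply_sub_left,
      s_apply_sub_right, hA, hA', LinearEquiv.coe_one, id]
    module
  · intro p hp hd
    obtain rfl := (Nat.prime_dvd_prime_iff_eq hp Nat.prime_two).1 hd
    refine s_mul_s_pow_apply_eq 2 0 _ hij ?_ (by norm_num)
    conv_lhs => rw [← sub_zero_smul_sub_zero_smul (D.α i) (D.α i) (D.α j)]
    simp only [Nat.reduceDiv, pow_succ, pow_zero, one_mul, LinearEquiv.mul_apply, s_apply_sub_left,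
      s_apply_sub_right, hA, hA', cr_α_self]
    module

theorem m_eq_three (hij : i ≠ j) (hA : D.cr j (D.α i) = -1) (hA' : D.cr i (D.α j) = -1) :
    D.m i j = 3 := by
  refine orderOf_eq_of_pow_and_pow_div_prime (by norm_num) (LinearEquiv.ext fun x => ?_) ?_
  · rw [← sub_zero_smul_sub_zero_smul x (D.α i) (D.α j)]
    simp only [pow_succ, pow_zero, one_mul, LinearEquiv.mul_apply, s_apply_sub_left,
      s_apply_sub_right, hA, hA', LinearEquiv.coe_one, id]
    module
  · intro p hp hd
    obtain rfl := (Nat.prime_dvd_prime_iff_eq hp Nat.prime_three).1 hd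
    refine s_mul_s_pow_apply_eq 1 (-1) _ hij ?_ (by norm_num)
    conv_lhs => rw [← sub_zero_smul_sub_zero_smul (D.α i) (D.α i) (D.α j)]
    simp only [Nat.reduceDiv, pow_succ, pow_zero, one_mul, LinearEquiv.mul_apply, s_apply_sub_left,
      s_apply_sub_right, hA, hA', cr_α_self]
    module

theorem m_eq_four (hij : i ≠ j) (hA : D.cr j (D.α i) = -1) (hA' : D.cr i (D.α j) = -2) :
    D.m i j = 4 := by
  refine orderOf_eq_of_pow_and_pow_div_prime (by norm_num) (LinearEquiv.ext fun x => ?_) ?_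
  · rw [← sub_zero_smul_sub_zero_smul x (D.α i) (D.α j)]
    simp only [pow_succ, pow_zero, one_mul, LinearEquiv.mul_apply, s_apply_sub_left,
      s_apply_sub_right, hA, hA', LinearEquiv.coe_one, id]
    module
  · intro p hp hd
    obtain rfl := (Nat.prime_dvd_prime_iff_eq hp Nat.prime_two).1
      (hp.dvd_of_dvd_pow (n := 2) (by norm_num; exact hd))
    refine s_mul_s_pow_apply_eq 2 0 _ hij ?_ (by norm_num)
    conv_lhs => rw [← sub_zero_smul_sub_zero_smul (D.α i) (D.α i) (D.α j)]
    simp only [Nat.reduceDiv, pow_succ, pow_zero, one_mul, LinearEquiv.mul_apply, s_apply_sub_left,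
      s_apply_sub_right, hA, hA', cr_α_self]
    module

theorem m_eq_six (hij : i ≠ j) (hA : D.cr j (D.α i) = -1) (hA' : D.cr i (D.α j) = -3) :
    D.m i j = 6 := by
  refine orderOf_eq_of_pow_and_pow_div_prime (by norm_num) (LinearEquiv.ext fun x => ?_) ?_
  · rw [← sub_zero_smul_sub_zero_smul x (D.α i) (D.α j)]
    simp only [pow_succ, pow_zero, one_mul, LinearEquiv.mul_apply, s_apply_sub_left,
      s_apply_sub_right, hA, hA', LinearEquiv.coe_one, id]
    module
  · intro p hp hd
    have hp' : p = 2 ∨ p = 3 := by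
      rcases (hp.dvd_mul).1 (show p ∣ 2 * 3 from hd) with h | h
      · exact Or.inl ((Nat.prime_dvd_prime_iff_eq hp Nat.prime_two).1 h)
      · exact Or.inr ((Nat.prime_dvd_prime_iff_eq hp Nat.prime_three).1 h)
    rcases hp' with rfl | rfl
    · refine s_mul_s_pow_apply_eq 2 0 _ hij ?_ (by norm_num)
      conv_lhs => rw [← sub_zero_smul_sub_zero_smul (D.α i) (D.α i) (D.α j)]
      simp only [Nat.reduceDiv, pow_succ, pow_zero, one_mul, LinearEquiv.mul_apply, s_apply_sub_left,
        s_apply_sub_right, hA, hA', cr_α_self]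
      module
    · refine s_mul_s_pow_apply_eq 0 (-1) _ hij ?_ (by norm_num)
      conv_lhs => rw [← sub_zero_smul_sub_zero_smul (D.α i) (D.α i) (D.α j)]
      simp only [Nat.reduceDiv, pow_succ, pow_zero, one_mul, LinearEquiv.mul_apply, s_apply_sub_left,
        s_apply_sub_right, hA, hA', cr_α_self]
      module

theorem altProd_s_two (hA : D.cr j (D.α i) = 0) (hA' : D.cr i (D.α j) = 0) :
    altProd 2 (D.s i) (D.s j) = altProd 2 (D.s j) (D.s i) := by
  refine LinearEquiv.ext fun x => ?_
  rw [← sub_zero_smul_sub_zero_smul x (D.α i) (D.α j)]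
  simp only [altProd, mul_one, LinearEquiv.mul_apply, s_apply_sub_left, s_apply_sub_right, hA, hA']
  module

theorem altProd_s_three (hA : D.cr j (D.α i) = -1) (hA' : D.cr i (D.α j) = -1) :
    altProd 3 (D.s i) (D.s j) = altProd 3 (D.s j) (D.s i) := by
  refine LinearEquiv.ext fun x => ?_
  rw [← sub_zero_smul_sub_zero_smul x (D.α i) (D.α j)]
  simp only [altProd, mul_one, LinearEquiv.mul_apply, s_apply_sub_left, s_apply_sub_right, hA, hA']
  module

theorem altProd_s_four (hA : D.cr j (D.α i) = -1) (hA' : D.cr i (D.α j) = -2) :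
    altProd 4 (D.s i) (D.s j) = altProd 4 (D.s j) (D.s i) := by
  refine LinearEquiv.ext fun x => ?_
  rw [← sub_zero_smul_sub_zero_smul x (D.α i) (D.α j)]
  simp only [altProd, mul_one, LinearEquiv.mul_apply, s_apply_sub_left, s_apply_sub_right, hA, hA']
  module

theorem altProd_s_six (hA : D.cr j (D.α i) = -1) (hA' : D.cr i (D.α j) = -3) :
    altProd 6 (D.s i) (D.s j) = altProd 6 (D.s j) (D.s i) := by
  refine LinearEquiv.ext fun x => ?_
  rw [← sub_zero_smul_sub_zero_smul x (D.α i) (D.α j)]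
  simp only [altProd, mul_one, LinearEquiv.mul_apply, s_apply_sub_left, s_apply_sub_right, hA, hA']
  module

theorem m_comm (i j : D.Simple) : D.m i j = D.m j i := by
  have h : D.s j * D.s i = (D.s i * D.s j)⁻¹ := by
    have hs (k : D.Simple) : D.s k * D.s k = 1 := LinearEquiv.ext fun x => by
      simp [s]
    rw [eq_inv_iff_mul_eq_one, mul_assoc, ← mul_assoc (D.s i), hs, one_mul, hs]
  rw [m, m, h, orderOf_inv]

theorem cr_α_cases [Finite ι] [D.P.IsReduced] (hij : i ≠ j) :
    (D.cr j (D.α i), D.cr i (D.α j)) ∈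
      ({(0, 0), (-1, -1), (-1, -2), (-2, -1), (-1, -3), (-3, -1)} : Set (ℤ × ℤ)) := by
  have e (i j : D.Simple) : D.cr j (D.α i) = D.P.pairingIn ℤ i j := by
    have := D.P.algebraMap_pairingIn ℤ i j
    rw [cr, α, D.P.root_coroot'_eq_pairing, ← this]
    rfl
  have hne : D.P.root i ≠ D.P.root j := by
    intro h
    exact hij (Subtype.ext (D.P.root.injective h))
  have hne' : D.P.root i ≠ -D.P.root j := by
    intro h
    have := smul_α_add_smul_α_eq_zero hij (a := 1) (b := 1)
      (by simp only [one_smul, α]; rw [h, neg_add_cancel])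
    omega
  have h := D.P.pairingIn_pairingIn_mem_set_of_isCrystal_of_isRed' i j hne hne'
  -- The classification for reduced crystallographic systems also allows positive pairings; distinct
  -- simple roots exclude them.
  have h₀ := D.base.pairingIn_le_zero_of_ne (fun h => hij (Subtype.ext h)) i.2 j.2
  rw [e, e]
  simp only [Set.mem_insert_iff, Set.mem_singleton_iff, Prod.mk.injEq] at h ⊢
  omega

end Reflections

end MetaplecticDatum
end

/-! ### Uniform statements for the three connected rank two types. -/

section Braid

variable {K M : Type*} [Field K] [Algebra ℂ K] [AddCommGroup M] [Module ℂ M] [Module K M]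
  [IsScalarTower ℂ K M] {v : ℂ} {σ τ : K →ₐ[ℂ] K} {p q : K} {T U : Module.End ℂ M}

theorem IsDemazureLusztig.altProd_of_cartan [CharZero K] (hT : IsDemazureLusztig v σ p T)
    (hU : IsDemazureLusztig v τ q U) {k m : ℕ} (hkm : k = 1 ∧ m = 3 ∨ k = 2 ∧ m = 4 ∨ k = 3 ∧ m = 6)
    (hσp : σ p = p⁻¹) (hτq : τ q = q⁻¹) (hσ : σ q = p ^ k * q) (hτ : τ p = p * q)
    (h : ∀ a b : ℕ, a ≠ 0 ∨ b ≠ 0 → p ^ a * q ^ b - 1 ≠ 0) (hp : p ≠ 0) (hq : q ≠ 0) :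
    altProd m (intertwiner v p T) (intertwiner v q U) -
      altProd m (intertwiner v q U) (intertwiner v p T) = altProd m T U - altProd m U T := by
  have h₁ : p - 1 ≠ 0 := by simpa using h 1 0 (by norm_num)
  have h₂ : q - 1 ≠ 0 := by simpa using h 0 1 (by norm_num)
  have h₃ : p * q - 1 ≠ 0 := by simpa using h 1 1 (by norm_num)
  rcases hkm with ⟨rfl, rfl⟩ | ⟨rfl, rfl⟩ | ⟨rfl, rfl⟩
  · rw [pow_one] at hσ
    exact hT.altProd_three hU hσp hτq hσ hτ h₁ h₃ h₂ hp hq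
  · have h₄ : p ^ 2 * q - 1 ≠ 0 := by simpa using h 2 1 (by norm_num)
    exact hT.altProd_four hU hσp hτq hσ hτ h₁ h₄ h₃ h₂ hp hq
  · have h₄ : p ^ 3 * q - 1 ≠ 0 := by simpa using h 3 1 (by norm_num)
    have h₅ : p ^ 2 * q - 1 ≠ 0 := by simpa using h 2 1 (by norm_num)
    exact hT.altProd_six hU hσp hτq hσ hτ h₁ h₄ h₅ (h 3 2 (by norm_num)) h₃ h₂ hp hq

theorem RankTwoOrbit.altProd_apply {X : Type*} [AddCommGroup X] {w : X → M} {α β : X}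
    {ℓ₁ ℓ₂ : X → ℤ} {k m : ℕ} {n₁ n₂ : ℤ} {γ₁ γ₂ : ℤ → ℂ}
    (hkm : k = 1 ∧ m = 3 ∨ k = 2 ∧ m = 4 ∨ k = 3 ∧ m = 6)
    (h : RankTwoOrbit T U w α β ℓ₁ ℓ₂ (-1) k n₁ n₂ γ₁ γ₂) (hγ : k = 1 → γ₂ = γ₁) {μ : X}
    (hμ : IsMinimalPair (-1) k n₁ n₂ (ℓ₁ μ) (ℓ₂ μ)) (ha : ℓ₁ μ ≤ 0) (hb : ℓ₂ μ ≤ 0) :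
    altProd m T U (w μ) = altProd m U T (w μ) := by
  rcases hkm with ⟨rfl, rfl⟩ | ⟨rfl, rfl⟩ | ⟨rfl, rfl⟩
  · rw [hγ rfl] at h
    exact h.altProd_three_apply hμ ha hb
  · exact h.altProd_four_apply hμ ha hb
  · exact h.altProd_six_apply hμ ha hb

end Braid

noncomputable section

namespace MetaplecticDatum

/-! ### Braid relations for the metaplectic operators. -/

section Braid

variable {ι X Y : Type*} [AddCommGroup X] [AddCommGroup Y] [Module.Free ℤ X]
  {D : MetaplecticDatum ι X Y} {i j : D.Simple}

theorem altProd_sRat_zMon (m : ℕ) (i j : D.Simple) (μ : X) :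
    altProd m (D.sRat i : LatticeRatFun X →ₐ[ℂ] LatticeRatFun X) (D.sRat j) (zMon μ) =
      zMon (altProd m (D.s i) (D.s j) μ) := by
  induction m generalizing i j with
  | zero => rfl
  | succ m ih =>
    rw [altProd, AlgHom.mul_apply, ih j i, AlgEquiv.coe_toAlgHom, sRat_zMon, altProd,
      LinearEquiv.mul_apply]

theorem altProd_sRat {m : ℕ} (h : altProd m (D.s i) (D.s j) = altProd m (D.s j) (D.s i)) :
    altProd m (D.sRat i : LatticeRatFun X →ₐ[ℂ] LatticeRatFun X) (D.sRat j) =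
      altProd m (D.sRat j : LatticeRatFun X →ₐ[ℂ] LatticeRatFun X) (D.sRat i) :=
  LatticeRatFun.algHom_ext fun μ => by rw [altProd_sRat_zMon, altProd_sRat_zMon, h]

theorem Z_pow_mul_Z_pow_sub_one_ne_zero (hij : i ≠ j) {a b : ℕ} (hab : a ≠ 0 ∨ b ≠ 0) :
    Z i ^ a * Z j ^ b - 1 ≠ 0 := by
  rw [← zpow_natCast, ← zpow_natCast, Z_zpow, Z_zpow, ← zMon_add]
  refine zMon_sub_one_ne_zero fun h => ?_
  obtain ⟨h₁, h₂⟩ := smul_α_add_smul_α_eq_zero hij h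
  have hi := D.nn_pos i
  have hj := D.nn_pos j
  simp only [mul_eq_zero, Nat.cast_eq_zero] at h₁ h₂
  omega

theorem sRat_Z_of_eq {b : ℕ} (h : (D.nn j : ℤ) * -D.cr i (D.α j) = b * D.nn i) :
    (D.sRat i : LatticeRatFun X →ₐ[ℂ] LatticeRatFun X) (Z j) = Z i ^ b * Z j := by
  rw [AlgEquiv.coe_toAlgHom, Z, sRat_zMon, ← zpow_natCast, Z_zpow, ← zMon_add, ← h, map_smul,
    s_apply]
  congr 1
  module

/-- The multiples `n_i α_i`, `n_j α_j` span a rank two system with the same Cartan matrix or its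
transpose: its off-diagonal entries are `-a`, `-b` with `a b = k`, and `k` is `1` or prime. In the
transposed case long and short are exchanged in the Yang-Baxter identity, but not in the orbit
argument, which uses the original roots. -/
theorem exists_cartan {k : ℕ} (hk : k = 1 ∨ k = 2 ∨ k = 3) (hA : D.cr j (D.α i) = -1)
    (hA' : D.cr i (D.α j) = -k) :
    ((D.sRat i : LatticeRatFun X →ₐ[ℂ] LatticeRatFun X) (Z j) = Z i ^ k * Z j ∧
      (D.sRat j : LatticeRatFun X →ₐ[ℂ] LatticeRatFun X) (Z i) = Z i * Z j) ∨
    ((D.sRat j : LatticeRatFun X →ₐ[ℂ] LatticeRatFun X) (Z i) = Z j ^ k * Z i ∧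
      (D.sRat i : LatticeRatFun X →ₐ[ℂ] LatticeRatFun X) (Z j) = Z j * Z i) := by
  have hi := D.nn_pos i
  have hj := D.nn_pos j
  have h₁ := D.nn_dvd i j
  have h₂ := D.nn_dvd j i
  rw [hA', mul_neg, dvd_neg] at h₁
  rw [hA, mul_neg_one, dvd_neg] at h₂
  obtain ⟨a, ha⟩ : D.nn j ∣ D.nn i := by exact_mod_cast h₂
  obtain ⟨b, hb⟩ : D.nn i ∣ D.nn j * k := by exact_mod_cast h₁
  have hab : a * b = k := by
    refine Nat.eq_of_mul_eq_mul_left hj ?_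
    rw [hb, ha, mul_assoc]
  have hcase : a = 1 ∧ b = k ∨ a = k ∧ b = 1 := by
    rcases hk with rfl | rfl | rfl
    · have := Nat.eq_one_of_mul_eq_one_right hab
      have := Nat.eq_one_of_mul_eq_one_left hab
      omega
    · rcases (Nat.dvd_prime Nat.prime_two).1 (Dvd.intro _ hab) with rfl | rfl <;> omega
    · rcases (Nat.dvd_prime Nat.prime_three).1 (Dvd.intro _ hab) with rfl | rfl <;> omega
  have e₁ : (D.sRat i : LatticeRatFun X →ₐ[ℂ] LatticeRatFun X) (Z j) = Z i ^ b * Z j :=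
    sRat_Z_of_eq (by rw [hA', neg_neg, mul_comm (b : ℤ)]; exact_mod_cast hb)
  have e₂ : (D.sRat j : LatticeRatFun X →ₐ[ℂ] LatticeRatFun X) (Z i) = Z j ^ a * Z i :=
    sRat_Z_of_eq (by rw [hA, neg_neg, mul_one, mul_comm (a : ℤ)]; exact_mod_cast ha)
  rcases hcase with ⟨rfl, rfl⟩ | ⟨rfl, rfl⟩
  · exact Or.inl ⟨e₁, by rw [e₂, pow_one, mul_comm]⟩
  · exact Or.inr ⟨e₂, by rw [e₁, pow_one, mul_comm]⟩

variable [Module.Finite ℤ X] {Γ : Set X} (hΓ : D.IsRepSystem Γ) {v : ℂ} {g : ℤ → ℂ}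

theorem altProd_inter_two (hg : IsGaussSumFamily D.n v g) (hA : D.cr j (D.α i) = 0)
    (hA' : D.cr i (D.α j) = 0) :
    altProd 2 (inter hΓ v g i) (inter hΓ v g j) - altProd 2 (inter hΓ v g j) (inter hΓ v g i) =
      altProd 2 (D.demazure v g hΓ i) (D.demazure v g hΓ j) -
        altProd 2 (D.demazure v g hΓ j) (D.demazure v g hΓ i) := by
  refine (isDemazureLusztig_demazure hΓ hg i).altProd_two (isDemazureLusztig_demazure hΓ hg j) ?_ ?_
  · rw [sRat_Z_of_eq (b := 0) (by simp [hA']), pow_zero, one_mul]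
  · rw [sRat_Z_of_eq (b := 0) (by simp [hA]), pow_zero, one_mul]

theorem altProd_inter_of_sRat (hg : IsGaussSumFamily D.n v g) (hij : i ≠ j) {k m : ℕ}
    (hkm : k = 1 ∧ m = 3 ∨ k = 2 ∧ m = 4 ∨ k = 3 ∧ m = 6)
    (hσ : (D.sRat i : LatticeRatFun X →ₐ[ℂ] LatticeRatFun X) (Z j) = Z i ^ k * Z j)
    (hτ : (D.sRat j : LatticeRatFun X →ₐ[ℂ] LatticeRatFun X) (Z i) = Z i * Z j) :
    altProd m (inter hΓ v g i) (inter hΓ v g j) - altProd m (inter hΓ v g j) (inter hΓ v g i) =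
      altProd m (D.demazure v g hΓ i) (D.demazure v g hΓ j) -
        altProd m (D.demazure v g hΓ j) (D.demazure v g hΓ i) := by
  have : CharZero (LatticeRatFun X) := algebraRat.charZero _
  exact (isDemazureLusztig_demazure hΓ hg i).altProd_of_cartan (isDemazureLusztig_demazure hΓ hg j)
    hkm (sRat_Z i) (sRat_Z j) hσ hτ (fun a b hab => Z_pow_mul_Z_pow_sub_one_ne_zero hij hab)
    (Z_ne_zero i) (Z_ne_zero j)

theorem altProd_inter (hg : IsGaussSumFamily D.n v g) (hij : i ≠ j) {k m : ℕ}
    (hkm : k = 1 ∧ m = 3 ∨ k = 2 ∧ m = 4 ∨ k = 3 ∧ m = 6)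
    (hA : D.cr j (D.α i) = -1) (hA' : D.cr i (D.α j) = -k) :
    altProd m (inter hΓ v g i) (inter hΓ v g j) - altProd m (inter hΓ v g j) (inter hΓ v g i) =
      altProd m (D.demazure v g hΓ i) (D.demazure v g hΓ j) -
        altProd m (D.demazure v g hΓ j) (D.demazure v g hΓ i) := by
  rcases exists_cartan (by omega) hA hA' with ⟨hσ, hτ⟩ | ⟨hσ, hτ⟩
  · exact altProd_inter_of_sRat hΓ hg hij hkm hσ hτ
  · have := altProd_inter_of_sRat hΓ hg hij.symm hkm hσ hτ
    rw [← neg_sub, this, neg_sub]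

theorem rankTwoOrbit (hg : IsGaussSumFamily D.n v g) {A k : ℤ} (hk : 0 < k)
    (hkA : k * A ^ 2 < 4) (hA₀ : A ≤ 0) (hA : D.cr j (D.α i) = A)
    (hA' : D.cr i (D.α j) = k * A) :
    RankTwoOrbit (D.demazure v g hΓ i) (D.demazure v g hΓ j) (vec hΓ) (D.α i) (D.α j) (ell i)
      (ell j) A k (D.nn i) (D.nn j) (smallCoef g (D.Q (D.α i))) (smallCoef g (D.Q (D.α j))) where
  left_sub_left μ c := by rw [ell_sub_zsmul, cr_α_self, mul_comm]
  right_sub_left μ c := by rw [ell_sub_zsmul, hA]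
  left_sub_right μ c := by rw [ell_sub_zsmul, hA']
  right_sub_right μ c := by rw [ell_sub_zsmul, cr_α_self, mul_comm]
  left_apply μ h₁ h₂ := demazure_vec hΓ hg i μ h₁ h₂
  right_apply μ h₁ h₂ := demazure_vec hΓ hg j μ h₁ h₂
  left_ne_zero a := smallCoef_ne_zero hg _ a
  right_ne_zero a := smallCoef_ne_zero hg _ a
  left_pos := by exact_mod_cast D.nn_pos i
  right_pos := by exact_mod_cast D.nn_pos j
  left_dvd := hA' ▸ D.nn_dvd i j
  right_dvd := hA ▸ D.nn_dvd j i
  ratio_pos := hk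
  weight_lt := hkA
  nonpos := hA₀

theorem exists_vec_eq_smul (i j : D.Simple) (μ : X) (s t : ℤ) :
    ∃ c : LatticeRatFun X, vec hΓ μ =
      c • vec hΓ (μ + (s • (D.nn i : ℤ) • D.α i + t • (D.nn j : ℤ) • D.α j)) := by
  have hν : s • (D.nn i : ℤ) • D.α i + t • (D.nn j : ℤ) • D.α j ∈ D.Λn :=
    add_mem (zsmul_mem (D.nn_smul_mem i) s) (zsmul_mem (D.nn_smul_mem j) t)
  refine ⟨zMon (s • (D.nn i : ℤ) • D.α i + t • (D.nn j : ℤ) • D.α j), ?_⟩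
  rw [vec_add hΓ μ hν, smul_smul, zMon_mul_zMon_neg, one_smul]

theorem altProd_demazure_two (hg : IsGaussSumFamily D.n v g) (hA : D.cr j (D.α i) = 0)
    (hA' : D.cr i (D.α j) = 0) :
    altProd 2 (D.demazure v g hΓ i) (D.demazure v g hΓ j) =
      altProd 2 (D.demazure v g hΓ j) (D.demazure v g hΓ i) := by
  have h := rankTwoOrbit hΓ hg one_pos (by norm_num) le_rfl hA (hA'.trans (one_mul 0).symm)
  exact altProd_eq_of_rankTwoOrbit (isDemazureLusztig_demazure hΓ hg i)
    (isDemazureLusztig_demazure hΓ hg j) (by norm_num) (altProd_sRat (altProd_s_two hA hA'))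
    (altProd_inter_two hΓ hg hA hA') h (fun μ hμ h₁ h₂ => h.altProd_two_apply hμ h₁ h₂)
    (exists_vec_eq_smul hΓ i j) (span_range_vec hΓ)

theorem altProd_demazure_of_cr (hg : IsGaussSumFamily D.n v g) (hij : i ≠ j) {k m : ℕ}
    (hkm : k = 1 ∧ m = 3 ∨ k = 2 ∧ m = 4 ∨ k = 3 ∧ m = 6) (hA : D.cr j (D.α i) = -1)
    (hA' : D.cr i (D.α j) = -k)
    (hs : altProd m (D.s i) (D.s j) = altProd m (D.s j) (D.s i)) :
    altProd m (D.demazure v g hΓ i) (D.demazure v g hΓ j) =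
      altProd m (D.demazure v g hΓ j) (D.demazure v g hΓ i) := by
  have h := rankTwoOrbit hΓ hg (k := k) (by omega) (by norm_num; omega) (by norm_num) hA
    (by rw [hA', mul_neg_one])
  -- In the simply laced case both roots have the same `Q`, which supplies the common scalar
  -- function needed for `m = 3`.
  have hQ (hk : k = 1) : smallCoef g (D.Q (D.α j)) = smallCoef g (D.Q (D.α i)) := by
    have := D.Q_mul_cr i j
    rw [hA, hA', hk] at this
    rw [show D.Q (D.α j) = D.Q (D.α i) by push_cast at this; linarith]
  exact altProd_eq_of_rankTwoOrbit (isDemazureLusztig_demazure hΓ hg i)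
    (isDemazureLusztig_demazure hΓ hg j) (by omega) (altProd_sRat hs)
    (altProd_inter hΓ hg hij hkm hA hA') h (fun μ hμ h₁ h₂ => h.altProd_apply hkm hQ hμ h₁ h₂)
    (exists_vec_eq_smul hΓ i j) (span_range_vec hΓ)

theorem altProd_demazure [Finite ι] [D.P.IsReduced] (hg : IsGaussSumFamily D.n v g)
    (i j : D.Simple) :
    altProd (D.m i j) (D.demazure v g hΓ i) (D.demazure v g hΓ j) =
      altProd (D.m i j) (D.demazure v g hΓ j) (D.demazure v g hΓ i) := by
  rcases eq_or_ne i j with rfl | hij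
  · rfl
  have h := cr_α_cases hij
  simp only [Set.mem_insert_iff, Set.mem_singleton_iff, Prod.mk.injEq] at h
  rcases h with ⟨hA, hA'⟩ | ⟨hA, hA'⟩ | ⟨hA, hA'⟩ | ⟨hA, hA'⟩ | ⟨hA, hA'⟩ | ⟨hA, hA'⟩
  · rw [m_eq_two hij hA hA']; exact altProd_demazure_two hΓ hg hA hA'
  · rw [m_eq_three hij hA hA']
    exact altProd_demazure_of_cr hΓ hg hij (k := 1) (by norm_num) hA (by simpa using hA')
      (altProd_s_three hA hA')
  · rw [m_eq_four hij hA hA']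
    exact altProd_demazure_of_cr hΓ hg hij (k := 2) (by norm_num) hA (by simpa using hA')
      (altProd_s_four hA hA')
  · rw [m_comm, m_eq_four hij.symm hA' hA]
    exact (altProd_demazure_of_cr hΓ hg hij.symm (k := 2) (by norm_num) hA' (by simpa using hA)
      (altProd_s_four hA' hA)).symm
  · rw [m_eq_six hij hA hA']
    exact altProd_demazure_of_cr hΓ hg hij (k := 3) (by norm_num) hA (by simpa using hA')
      (altProd_s_six hA hA')
  · rw [m_comm, m_eq_six hij.symm hA' hA]
    exact (altProd_demazure_of_cr hΓ hg hij.symm (k := 3) (by norm_num) hA' (by simpa using hA)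
      (altProd_s_six hA' hA)).symm

end Braid

end MetaplecticDatum
end

noncomputable section

theorem map_altProd {G R S : Type*} [Monoid R] [Monoid S] [FunLike G R S] [MonoidHomClass G R S]
    (f : G) (m : ℕ) (a b : R) : f (altProd m a b) = altProd m (f a) (f b) := by
  induction m generalizing a b with
  | zero => exact map_one f
  | succ m ih => rw [altProd, altProd, map_mul, ih]

theorem sub_algebraMap_mul_add_one {R : Type*} [Ring R] [Algebra ℂ R] {v : ℂ} {t : R}
    (h : t * t = (v - 1) • t + v • 1) : (t - algebraMap ℂ R v) * (t + 1) = 0 := by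
  rw [mul_add, sub_mul, mul_one, h, Algebra.algebraMap_eq_smul_one, smul_mul_assoc, one_mul,
    sub_smul, one_smul]
  abel

namespace MetaplecticDatum

/-! ### Assembling the Hecke algebra action. -/

section Hecke

variable {ι X Y : Type*} [AddCommGroup X] [AddCommGroup Y] [Module.Free ℤ X]
  {D : MetaplecticDatum ι X Y} {Γ : Set X} (hΓ : D.IsRepSystem Γ) {v : ℂ} {g : ℤ → ℂ}

/-- The homomorphism `z ^ μ ↦ z ^ (-μ)` from the group algebra of `Λ^(n)` to `ℂ(Λ)`. -/
def invMonHom (D : MetaplecticDatum ι X Y) : AddMonoidAlgebra ℂ D.Λn →ₐ[ℂ] LatticeRatFun X :=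
  AddMonoidAlgebra.lift ℂ (LatticeRatFun X) D.Λn
    { toFun μ := zMon (-(μ.toAdd : X))
      map_one' := by simp [zMon_zero]
      map_mul' μ ν := by simp [← zMon_add, add_comm] }

theorem invMonHom_single (μ : D.Λn) :
    D.invMonHom (AddMonoidAlgebra.single μ 1) = zMon (-(μ : X)) := by
  rw [invMonHom, AddMonoidAlgebra.lift_single, one_smul]
  rfl

/-- The action of the free algebra on the generators of the Hecke algebra. -/
def freeAction (v : ℂ) (g : ℤ → ℂ) :
    FreeAlgebra ℂ D.HeckeGen →ₐ[ℂ] Module.End ℂ (Γ → LatticeRatFun X) :=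
  FreeAlgebra.lift ℂ fun
    | .T i => D.demazure v g hΓ i
    | .θ μ => Algebra.lsmul ℂ ℂ (Γ → LatticeRatFun X) (zMon (-(μ : X)))

theorem freeAction_freeT (i : D.Simple) :
    freeAction hΓ v g (D.freeT i) = D.demazure v g hΓ i :=
  FreeAlgebra.lift_ι_apply _ _

theorem freeAction_freeθ (μ : D.Λn) :
    freeAction hΓ v g (D.freeθ μ) =
      Algebra.lsmul ℂ ℂ (Γ → LatticeRatFun X) (zMon (-(μ : X))) :=
  FreeAlgebra.lift_ι_apply _ _

theorem freeAction_freeθLin (x : AddMonoidAlgebra ℂ D.Λn) :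
    freeAction hΓ v g (D.freeθLin x) =
      Algebra.lsmul ℂ ℂ (Γ → LatticeRatFun X) (D.invMonHom x) := by
  rw [freeθLin, invMonHom, AddMonoidAlgebra.lift_apply, Finsupp.sum, Finsupp.sum, map_sum, map_sum]
  refine Finset.sum_congr rfl fun μ _ => ?_
  rw [map_smul, map_smul, freeAction_freeθ]
  rfl

/-- Since `ϑ_λ` acts by `z^(-λ)`, the denominator `1 - ϑ_{-n_i α_i}` becomes `1 - Z_i`, which is, up
to sign, the denominator of the Demazure coefficient. -/
theorem Dcoef_mul_sub_eq {i : D.Simple} {μ : D.Λn} {x : AddMonoidAlgebra ℂ D.Λn}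
    (hx : x * (1 - AddMonoidAlgebra.single (-D.nα i) 1) =
      AddMonoidAlgebra.single μ 1 - AddMonoidAlgebra.single (D.sΛn i μ) 1) (v : ℂ) :
    D.Dcoef v i * (zMon (-(D.s i μ : X)) - zMon (-(μ : X))) =
      algebraMap ℂ _ (1 - v) * D.invMonHom x := by
  have h := congrArg D.invMonHom hx
  rw [map_mul, map_sub, map_sub, map_one, invMonHom_single, invMonHom_single,
    invMonHom_single] at h
  have h' : D.invMonHom x * (1 - Z i) = zMon (-(μ : X)) - zMon (-(D.s i μ : X)) := by
    refine Eq.trans ?_ h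
    rw [Z]
    simp [nα]
  rw [map_sub, map_one, ← Dcoef_mul v i]
  linear_combination D.Dcoef v i * h'

theorem freeAction_bernstein {i : D.Simple} {μ : D.Λn} {x : AddMonoidAlgebra ℂ D.Λn}
    (hx : x * (1 - AddMonoidAlgebra.single (-D.nα i) 1) =
      AddMonoidAlgebra.single μ 1 - AddMonoidAlgebra.single (D.sΛn i μ) 1) :
    freeAction hΓ v g (D.freeθ μ * D.freeT i - D.freeT i * D.freeθ (D.sΛn i μ)) =
      freeAction hΓ v g ((v - 1) • D.freeθLin x) := by
  have hs : D.sRat i (zMon (-(D.s i μ : X))) = zMon (-(μ : X)) := by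
    rw [sRat_zMon, map_neg]
    simp [s]
  have h := Dcoef_mul_sub_eq hx v
  rw [map_sub, map_mul, map_mul, map_smul, freeAction_freeθ, freeAction_freeT, freeAction_freeθ,
    freeAction_freeθLin]
  refine LinearMap.ext fun f => ?_
  -- The scalar is `z^(-s_i μ)`, so that moving it past `T_i` produces `z^(-μ)`, the action of
  -- `ϑ_μ`.
  have e := demazure_smul hΓ (v := v) (g := g) i (zMon (-(D.s i μ : X))) f
  rw [AlgEquiv.coe_toAlgHom, hs, ← Dcoef_eq, h] at e
  rw [LinearMap.sub_apply, Module.End.mul_apply, Module.End.mul_apply, LinearMap.smul_apply,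
    Algebra.lsmul_coe, Algebra.lsmul_coe, Algebra.lsmul_coe]
  refine (congrArg (fun y => zMon (-(μ : X)) • D.demazure v g hΓ i f - y) e).trans ?_
  rw [sub_add_cancel_left, ← neg_smul, ← neg_mul, ← map_neg, neg_sub, mul_smul, algebraMap_smul]

variable [Module.Finite ℤ X]

theorem freeAction_eq_of_heckeRel [Finite ι] [D.P.IsReduced] (hg : IsGaussSumFamily D.n v g)
    ⦃a b : FreeAlgebra ℂ D.HeckeGen⦄ (h : D.HeckeRel v a b) :
    freeAction hΓ v g a = freeAction hΓ v g b := by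
  cases h with
  | quadratic i =>
    rw [map_mul, map_add, map_smul, map_smul, map_one, freeAction_freeT]
    exact (isDemazureLusztig_demazure hΓ hg i).mul_self
  | braid i j =>
    have e (i j : D.Simple) (m : ℕ) : freeAction hΓ v g (altProd m (D.freeT i) (D.freeT j)) =
        altProd m (D.demazure v g hΓ i) (D.demazure v g hΓ j) := by
      rw [← freeAction_freeT, ← freeAction_freeT]
      exact map_altProd (freeAction hΓ v g) m _ _
    rw [e, e]
    exact altProd_demazure hΓ hg i j
  | θ_zero =>
    rw [freeAction_freeθ, map_one, ZeroMemClass.coe_zero, neg_zero, zMon_zero, map_one]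
  | θ_add μ ν =>
    rw [map_mul, freeAction_freeθ, freeAction_freeθ, freeAction_freeθ, ← map_mul, ← zMon_add,
      AddSubgroup.coe_add, neg_add]
  | bernstein i μ x hx => exact freeAction_bernstein hΓ hx

theorem exists_heckeAction [Finite ι] [D.P.IsReduced] (hg : IsGaussSumFamily D.n v g) :
    ∃ ρ : D.Hecke v →ₐ[ℂ] Module.End ℂ (Γ → LatticeRatFun X),
      (∀ i : D.Simple, ρ (D.heckeT v i) = D.demazure v g hΓ i) ∧
      (∀ (μ : D.Λn) (f : Γ → LatticeRatFun X) (γ : Γ),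
        ρ (D.heckeθ v μ) f γ = zMon (-(μ : X)) * f γ) := by
  refine ⟨RingQuot.liftAlgHom ℂ ⟨freeAction hΓ v g, freeAction_eq_of_heckeRel hΓ hg⟩,
    fun i => ?_, fun μ f γ => ?_⟩
  · rw [heckeT, RingQuot.liftAlgHom_mkAlgHom_apply, freeAction_freeT]
  · rw [heckeθ, RingQuot.liftAlgHom_mkAlgHom_apply, freeAction_freeθ]
    rfl

theorem demazure_sub_mul_add_one (hg : IsGaussSumFamily D.n v g) (i : D.Simple) :
    (D.demazure v g hΓ i - algebraMap ℂ _ v) * (D.demazure v g hΓ i + 1) = 0 :=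
  sub_algebraMap_mul_add_one (isDemazureLusztig_demazure hΓ hg i).mul_self

end Hecke

end MetaplecticDatum

theorem isGaussSumFamily_metaplecticGaussSum {F : Type*} [Field F] [ValuativeRel F]
    [TopologicalSpace F] [IsNonarchimedeanLocalField F] {n : ℕ}
    (hn : Nat.card 𝓀[F] ≡ 1 [MOD 2 * n]) {ϖ : 𝒪[F]} (hϖ : Irreducible ϖ)
    {ε : rootsOfUnity n F →* ℂˣ} (hε : Function.Injective ε) {ψ : AddChar F ℂ}
    (hψ : ∀ x : 𝒪[F], ψ (x : F) = 1) (hψ' : ∃ x : 𝒪[F], ψ ((x : F) / (ϖ : F)) ≠ 1) :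
    IsGaussSumFamily n (localV F) (metaplecticGaussSum hn ϖ ε ψ) where
  ne_zero := left_ne_zero_of_mul_eq_one localV_mul_card
  of_dvd _ ha := metaplecticGaussSum_of_dvd hn hϖ ε hψ hψ' ha
  mul_neg _ ha := metaplecticGaussSum_mul_neg hn hϖ hε hψ hψ' ha
  congr _ _ hab := metaplecticGaussSum_congr hn ϖ ε ψ hab

end

theorem theorem3p12
    {F : Type*} [Field F] [ValuativeRel F] [TopologicalSpace F] [IsNonarchimedeanLocalField F]
    {ι X Y : Type*} [Finite ι] [AddCommGroup X] [AddCommGroup Y]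
    [Module.Free ℤ X] [Module.Finite ℤ X]
    (D : MetaplecticDatum ι X Y) [D.P.IsReduced]
    (hq : Nat.card 𝓀[F] ≡ 1 [MOD 2 * D.n])
    (ϖ : 𝒪[F]) (hϖ : Irreducible ϖ)
    (ε : rootsOfUnity D.n F →* ℂˣ) (hε : Function.Injective ε)
    (ψ : AddChar F ℂ) (hψ : ∀ x : 𝒪[F], ψ (x : F) = 1)
    (hψ' : ∃ x : 𝒪[F], ψ ((x : F) / (ϖ : F)) ≠ 1)
    (Γ : Set X) (hΓ : D.IsRepSystem Γ)
    (g : ℤ → ℂ) (hg : g = metaplecticGaussSum hq ϖ ε ψ)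
    (v : ℂ) (hv : v = localV F) :
    (∃ ρ : D.Hecke v →ₐ[ℂ] Module.End ℂ (Γ → LatticeRatFun X),
      (∀ i : D.Simple, ρ (D.heckeT v i) = D.demazure v g hΓ i) ∧
      (∀ (μ : D.Λn) (f : Γ → LatticeRatFun X) (γ : Γ),
        ρ (D.heckeθ v μ) f γ = zMon (-(μ : X)) * f γ)) ∧
    (∀ i j : D.Simple,
      altProd (D.m i j) (D.demazure v g hΓ i) (D.demazure v g hΓ j) =
        altProd (D.m i j) (D.demazure v g hΓ j) (D.demazure v g hΓ i)) ∧
    (∀ i : D.Simple,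
      (D.demazure v g hΓ i - algebraMap ℂ _ v) * (D.demazure v g hΓ i + 1) = 0) := by
  subst hg hv
  have h := isGaussSumFamily_metaplecticGaussSum hq hϖ hε hψ hψ'
  exact ⟨MetaplecticDatum.exists_heckeAction hΓ h,
    MetaplecticDatum.altProd_demazure hΓ h, MetaplecticDatum.demazure_sub_mul_add_one hΓ h⟩
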